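/- **Setting.** Let $G\subset GL(n,\mathbb C)$ be a compact connected (hence semisimple) matrix Lie group with trivial center and identity $e$. Let $h\in G$ be such that $\sigma(g)=hgh^{-1}$ satisfies $\sigma^2=\mathrm{id}$, let $\hat K=\{g\in G:\sigma(g)=g\}$, and let $\mathfrak C_h:G/\hat K\to G$, $g\hat K\mapsto ghg^{-1}$. Fix a symmetric submultiplicative weight $w:\mathbb Z\to[1,\infty)$. Let $\Lambda G$ be the group of loops $\gamma(\lambda)=\sum_k\lambda^k c_k\in G$ ($\lambda\in S^1$) with $\sum_k w(k)|c_k|<\infty$. Put $\Lambda G_\sigma=\{\gamma\in\Lambda G:\sigma(\gamma(-\lambda))=\gamma(\lambda)\}$, $\Omega G=\{\gamma\in\Lambda G:\gamma(1)=e\}$, and let $\Omega_{alg}G\subset\Omega G$ be the loops with finite Fourier expansion. Let $\Omega^k_{alg}G\subset\Omega_{alg}G$ be those with $\mathrm{Ad}\,\gamma=\sum_{|j|\le k}\lambda^jT_j$ on $\mathfrak g^{\mathbb C}$. Put $\mathbb T(\gamma)(\lambda)=\gamma(-\lambda)\gamma(-1)^{-1}$ and $(\Omega_{alg}G)_{\mathbb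 T}=\{\gamma\in\Omega_{alg}G:\mathbb T(\gamma)=\gamma\}$. Let $M$ be a connected Riemann surface with universal covering $\varpi:\tilde M\to M$. An *extended solution* for $\mathbb F:M\to G$ is a map $\Phi:M\to\Omega G$, smooth on $M$ for each $\lambda\in S^1$, with $\Phi(\cdot,-1)=\mathbb F$ and, for $\mathbb A=\frac12\mathbb F^{-1}d\mathbb F$, $$\partial_z\Phi=(1-\lambda^{-1})\,\Phi\,\mathbb A(\partial_z),\qquad \partial_{\bar z}\Phi=(1-\lambda)\,\Phi\,\mathbb A(\partial_{\bar z})\qquad(\lambda\in S^1).$$ Let $\mathcal F:M\to G/\hat K$ be a harmonic map of finite uniton number, i.e. $\mathbb F=\mathfrak C_h\circ\mathcal F$ has some extended solution with values in $\Omega^k_{alg}G$ for some $k$. Let $F:\tilde M\to\Lambda G_\sigma$ be an extended frame of $\mathcal F$ based at $z_0\in\tilde M$: $F(z,\lambda)$ is smooth in $z$ for each $\lambda$, $F(z_0,\lambda)=e$ for all $\lambda$, $F(z,1)\hat K=\mathcal F(\varpi(z))$, and $F_\lambda^{-1}dF_\lambda=\lambda^{-1}\alpha_{\mathfrak p}'+\alpha_{\mathfrak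 k}+\lambda\alpha_{\mathfrak p}''$ with $\alpha=F_1^{-1}dF_1$. (Here $\mathfrak k^{\mathbb C},\mathfrak p^{\mathbb C}$ are the $\pm1$-eigenspaces of $\mathrm{Ad}\,h$, and $'$, $''$ denote $(1,0)$- and $(0,1)$-parts; if $\tilde M=S^2$, then $F$ may have up to two singular points, different from $z_0$.) Let $\Phi$ be any extended solution for $\mathbb F$ on $M$, and put $A(1,\lambda)=\Phi(\varpi(z_0),\lambda)^{-1}$. **Proposition.** At every nonsingular point $z$ of $F$ and for all $\lambda\in S^1$, $$\Phi(\varpi(z),\lambda)=A(1,\lambda)^{-1}F(z,\lambda)F(z,1)^{-1}.$$ There is a maximal torus of $G$ containing $h$. Let $\mathrm T$ be any such torus, with Lie algebra $\mathfrak t$. Then there exists $\tilde\xi\in\mathfrak t$ with $\exp(\pi\tilde\xi)=h$. For every such $\tilde\xi$, $\gamma_{\tilde\xi}(e^{it})=\exp(t\tilde\xi)$ is a well-defined map $S^1\to G$, and $\tilde\gamma(\lambda)=\gamma_{\tilde\xi}(\lambda)A(1,\lambda)$ has the following properties: 1. $\tilde\gamma\in\Omega G$ and $\tilde\gamma(-1)=e$;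 2. $\tilde\gamma\Phi(p,\cdot)\in\Omega G$ and $\mathbb T(\tilde\gamma\Phi(p,\cdot))=\tilde\gamma\Phi(p,\cdot)$ for every $p\in M$; 3. $\tilde\gamma\Phi$ is again an extended solution for $\mathbb F$; 4. if $\Phi$ takes values in $\Omega_{alg}G$, then $\tilde\gamma\in\Omega_{alg}G$ and $\tilde\gamma\Phi$ takes values in $(\Omega_{alg}G)_{\mathbb T}$. -/

import Mathlib

open scoped Manifold ContDiff MatrixGroups

namespace UnitonLoops

noncomputable section

variable {n : ℕ} {G : Subgroup (GL (Fin n) ℂ)}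

/-! ### Matrix groups, involutions, maximal tori -/

/-- The matrix underlying an element of the matrix group `G ⊆ GL(n, ℂ)`. -/
def mat (g : G) : Matrix (Fin n) (Fin n) ℂ := ((g : GL (Fin n) ℂ) : Matrix (Fin n) (Fin n) ℂ)

/-- The Lie algebra of a subgroup `H` of `G`: the matrices `X` with `exp (t X) ∈ H` for all real `t`. -/
def lieAlg (H : Subgroup G) : Set (Matrix (Fin n) (Fin n) ℂ) :=
  {X | ∀ t : ℝ, ∃ g ∈ H, mat g = NormedSpace.exp (t • X)}

/-- The complexification `𝔤^ℂ` of the Lie algebra of (a compact) `G`, inside the complex matrices. -/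
def lieAlgC (G : Subgroup (GL (Fin n) ℂ)) : Submodule ℂ (Matrix (Fin n) (Fin n) ℂ) :=
  Submodule.span ℂ (lieAlg (⊤ : Subgroup G))

/-- A torus in `G`: a compact connected abelian subgroup. -/
structure IsTorus (T : Subgroup G) : Prop where
  compact : IsCompact (T : Set G)
  connected : IsConnected (T : Set G)
  comm : ∀ a ∈ T, ∀ b ∈ T, a * b = b * a

/-- A maximal torus of `G`: a torus that is contained in no larger torus. -/
def IsMaximalTorus (T : Subgroup G) : Prop := Maximal IsTorus T

/-- The inner automorphism `σ(g) = h g h⁻¹`. -/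
def sigma (h : G) : G →* G := (MulAut.conj h).toMonoidHom

/-- The fixed point group of `σ`. -/
def fixK (h : G) : Subgroup G := (sigma h).eqLocus (MonoidHom.id G)

/-- The modified Cartan embedding `G/Fix(σ) → G`, `g ↦ g h g⁻¹`. -/
def cartan (h : G) : G ⧸ fixK h → G :=
  Quotient.lift (s := QuotientGroup.leftRel (fixK h)) (fun g : G => g * h * g⁻¹) (by
    intro a b hab
    have h1 : a⁻¹ * b ∈ fixK h := QuotientGroup.leftRel_apply.mp hab
    have h2 : h * (a⁻¹ * b) * h⁻¹ = a⁻¹ * b := h1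
    have h3 : h * (a⁻¹ * b) = a⁻¹ * b * h := mul_inv_eq_iff_eq_mul.mp h2
    have h4 : b * h = a * h * a⁻¹ * b := by
      calc b * h = a * (a⁻¹ * b * h) := by group
        _ = a * (h * (a⁻¹ * b)) := by rw [h3]
        _ = a * h * a⁻¹ * b := by group
    change a * h * a⁻¹ = b * h * b⁻¹
    rw [h4]; group)

/-! ### Loops -/

/-- Admissible weights for weighted Wiener algebras on the circle. -/
structure IsLoopWeight (w : ℤ → ℝ) : Prop where
  one_le : ∀ k, 1 ≤ w k
  symm : ∀ k, w (-k) = w k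
  submul : ∀ k l, w (k + l) ≤ w k * w l

/-- The loop group `ΛG` for the weight `w`: loops `γ(λ) = ∑ λᵏ cₖ` in `G` with `∑ w(k) |cₖ| < ∞`
(the entries are summed separately, so that no matrix norm has to be chosen). -/
def loopGroup (G : Subgroup (GL (Fin n) ℂ)) (w : ℤ → ℝ) : Set (Circle → G) :=
  {γ | ∃ c : ℤ → Matrix (Fin n) (Fin n) ℂ,
    (∀ i j, Summable fun k => w k * ‖c k i j‖) ∧
    ∀ l : Circle, HasSum (fun k : ℤ => (l : ℂ) ^ k • c k) (mat (γ l))}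

/-- The twisted loop group `ΛG_σ`: loops with `σ(γ(-λ)) = γ(λ)`. -/
def twistedLoops (w : ℤ → ℝ) (h : G) : Set (Circle → G) :=
  {γ | γ ∈ loopGroup G w ∧ ∀ l : Circle, sigma h (γ (-l)) = γ l}

/-- The based loop group `ΩG`. -/
def basedLoops (G : Subgroup (GL (Fin n) ℂ)) (w : ℤ → ℝ) : Set (Circle → G) :=
  {γ | γ ∈ loopGroup G w ∧ γ 1 = 1}

/-- `Ω_alg G`: the based loops with a finite Fourier expansion. -/
def algLoops (G : Subgroup (GL (Fin n) ℂ)) : Set (Circle → G) :=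
  {γ | γ 1 = 1 ∧ ∃ (N : ℕ) (c : ℤ → Matrix (Fin n) (Fin n) ℂ),
    ∀ l : Circle, mat (γ l) = ∑ k ∈ Finset.Icc (-(N : ℤ)) N, (l : ℂ) ^ k • c k}

/-- `Ω^k_alg G`: the algebraic based loops `γ` with `Ad γ = ∑_{|j| ≤ k} λʲ T_j` on `𝔤^ℂ`. -/
def algLoopsOfDegree (G : Subgroup (GL (Fin n) ℂ)) (k : ℕ) : Set (Circle → G) :=
  {γ | γ ∈ algLoops G ∧ ∃ T : ℤ → (lieAlgC G →ₗ[ℂ] lieAlgC G),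
    ∀ (l : Circle) (X : lieAlgC G),
      mat (γ l) * (X : Matrix (Fin n) (Fin n) ℂ) * mat (γ l)⁻¹ =
        ∑ j ∈ Finset.Icc (-(k : ℤ)) k, (l : ℂ) ^ j • ((T j X : lieAlgC G) :
          Matrix (Fin n) (Fin n) ℂ)}

/-- The involution `𝕋(γ)(λ) = γ(-λ) γ(-1)⁻¹` on based loops. -/
def invT (γ : Circle → G) : Circle → G := fun l => γ (-l) * (γ (-1))⁻¹

/-- `(Ω_alg G)_𝕋`: the algebraic based loops fixed by `𝕋`. -/
def algLoopsT (G : Subgroup (GL (Fin n) ℂ)) : Set (Circle → G) :=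
  {γ | γ ∈ algLoops G ∧ invT γ = γ}

/-! ### Calculus for matrix valued maps in one complex coordinate -/

/-- `∂f/∂z = (∂f/∂x - i ∂f/∂y) / 2`, entry by entry. -/
def dz (f : ℂ → Matrix (Fin n) (Fin n) ℂ) (x : ℂ) : Matrix (Fin n) (Fin n) ℂ :=
  Matrix.of fun i j => (1 / 2 : ℂ) *
    (fderiv ℝ (fun y => f y i j) x 1 - Complex.I * fderiv ℝ (fun y => f y i j) x Complex.I)

/-- `∂f/∂z̄ = (∂f/∂x + i ∂f/∂y) / 2`, entry by entry. -/
def dzbar (f : ℂ → Matrix (Fin n) (Fin n) ℂ) (x : ℂ) : Matrix (Fin n) (Fin n) ℂ :=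
  Matrix.of fun i j => (1 / 2 : ℂ) *
    (fderiv ℝ (fun y => f y i j) x 1 + Complex.I * fderiv ℝ (fun y => f y i j) x Complex.I)

/-- The `dz`-coefficient of the Maurer-Cartan form `f⁻¹ df`. -/
def mcZ (f : ℂ → G) (x : ℂ) : Matrix (Fin n) (Fin n) ℂ :=
  mat (f x)⁻¹ * dz (fun y => mat (f y)) x

/-- The `dz̄`-coefficient of the Maurer-Cartan form `f⁻¹ df`. -/
def mcZbar (f : ℂ → G) (x : ℂ) : Matrix (Fin n) (Fin n) ℂ :=
  mat (f x)⁻¹ * dzbar (fun y => mat (f y)) x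

/-- The component of `X` in the `+1`-eigenspace `𝔨^ℂ` of `Ad h` (for `h² = e`). -/
def kPart (h : G) (X : Matrix (Fin n) (Fin n) ℂ) : Matrix (Fin n) (Fin n) ℂ :=
  (1 / 2 : ℂ) • (X + mat h * X * mat h⁻¹)

/-- The component of `X` in the `-1`-eigenspace `𝔭^ℂ` of `Ad h` (for `h² = e`). -/
def pPart (h : G) (X : Matrix (Fin n) (Fin n) ℂ) : Matrix (Fin n) (Fin n) ℂ :=
  (1 / 2 : ℂ) • (X - mat h * X * mat h⁻¹)

/-! ### Riemann surfaces, harmonic maps, extended solutions, extended frames -/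

section Surfaces

variable {M : Type*} [TopologicalSpace M] [ChartedSpace ℂ M]
variable {N : Type*} [TopologicalSpace N] [ChartedSpace ℂ N]

/-- A universal covering `π : N → M` of Riemann surfaces. -/
structure IsUniversalCovering (π : N → M) : Prop where
  simplyConnected : SimplyConnectedSpace N
  covering : IsCoveringMap π
  surjective : Function.Surjective π
  holomorphic : MDifferentiable 𝓘(ℂ) 𝓘(ℂ) π

/-- Smoothness (in the real sense) of a map from a surface into the matrix group `G`. -/
def SmoothInto (f : M → G) (U : Set M) : Prop :=
  ∀ i j, ContMDiffOn 𝓘(ℝ, ℂ) 𝓘(ℝ, ℂ) ∞ (fun p => mat (f p) i j) U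

/-- Harmonicity of `𝓕 : M → G/Fix(σ)`: locally, `𝓕` has a smooth lift `f` into `G` such that
`α = f⁻¹ df` satisfies the harmonic map equation `∂_z̄ α_𝔭(∂_z) + [α_𝔨(∂_z̄), α_𝔭(∂_z)] = 0`
in every holomorphic coordinate. -/
def IsHarmonic (h : G) (𝓕 : M → G ⧸ fixK h) : Prop :=
  ∀ p : M, ∃ (U : Set M) (f : M → G), IsOpen U ∧ p ∈ U ∧ SmoothInto f U ∧
    (∀ q ∈ U, (QuotientGroup.mk (f q) : G ⧸ fixK h) = 𝓕 q) ∧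
    ∀ φ ∈ atlas ℂ M, ∀ x ∈ φ.target, φ.symm x ∈ U →
      let α_z : ℂ → Matrix (Fin n) (Fin n) ℂ := mcZ (f ∘ φ.symm)
      let α_zbar : ℂ → Matrix (Fin n) (Fin n) ℂ := mcZbar (f ∘ φ.symm)
      dzbar (fun y => pPart h (α_z y)) x +
        (kPart h (α_zbar x) * pPart h (α_z x) - pPart h (α_z x) * kPart h (α_zbar x)) = 0

/-- `Φ : M → ΩG` is an extended solution for `𝔽 : M → G`: with `𝔸 = ½ 𝔽⁻¹ d𝔽`,
`∂_z Φ = (1 - λ⁻¹) Φ 𝔸_z`, `∂_z̄ Φ = (1 - λ) Φ 𝔸_z̄` (in every holomorphic coordinate),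
`Φ(·, 1) = e` (part of `Φ(p) ∈ ΩG`) and `Φ(·, -1) = 𝔽`. -/
structure IsExtendedSolution (w : ℤ → ℝ) (𝔽 : M → G) (Φ : M → Circle → G) : Prop where
  smooth : ∀ l : Circle, SmoothInto (fun p => Φ p l) Set.univ
  based : ∀ p, Φ p ∈ basedLoops G w
  eval_neg_one : ∀ p, Φ p (-1) = 𝔽 p
  eq_z : ∀ φ ∈ atlas ℂ M, ∀ x ∈ φ.target, ∀ l : Circle,
    dz (fun y => mat (Φ (φ.symm y) l)) x =
      (1 - (l : ℂ)⁻¹) • (mat (Φ (φ.symm x) l) * ((1 / 2 : ℂ) • mcZ (𝔽 ∘ φ.symm) x))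
  eq_zbar : ∀ φ ∈ atlas ℂ M, ∀ x ∈ φ.target, ∀ l : Circle,
    dzbar (fun y => mat (Φ (φ.symm y) l)) x =
      (1 - (l : ℂ)) • (mat (Φ (φ.symm x) l) * ((1 / 2 : ℂ) • mcZbar (𝔽 ∘ φ.symm) x))

/-- `𝔽 : M → G` has finite uniton number: it has a global extended solution `M → Ω^k_alg G`
for some `k`. -/
def HasFiniteUnitonNumber (w : ℤ → ℝ) (𝔽 : M → G) : Prop :=
  ∃ (k : ℕ) (Φ : M → Circle → G),
    IsExtendedSolution w 𝔽 Φ ∧ ∀ p, Φ p ∈ algLoopsOfDegree G k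

/-- `F` is an extended frame, based at `z₀`, of `𝓕 : M → G/Fix(σ)`. It is defined on the universal
covering `N` of `M`; when `N` is the sphere it may have a set `S` of at most two singular points
(the values of `F` at the points of `S` are irrelevant). With `α = F₁⁻¹ dF₁`,
`F_λ⁻¹ dF_λ = λ⁻¹ α_𝔭' + α_𝔨 + λ α_𝔭''`. -/
structure IsExtendedFrame (w : ℤ → ℝ) (h : G) (π : N → M) (𝓕 : M → G ⧸ fixK h)
    (z₀ : N) (S : Set N) (F : N → Circle → G) : Prop where
  sing_card : S.encard ≤ 2
  sing_sphere : S.Nonempty → CompactSpace N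
  base_notMem : z₀ ∉ S
  smooth : ∀ l : Circle, SmoothInto (fun z => F z l) Sᶜ
  twisted : ∀ z, z ∉ S → F z ∈ twistedLoops w h
  lift : ∀ z, z ∉ S → (QuotientGroup.mk (F z 1) : G ⧸ fixK h) = 𝓕 (π z)
  base : ∀ l : Circle, F z₀ l = 1
  mc_z : ∀ φ ∈ atlas ℂ N, ∀ x ∈ φ.target, φ.symm x ∉ S → ∀ l : Circle,
    mcZ (fun y => F (φ.symm y) l) x =
      (l : ℂ)⁻¹ • pPart h (mcZ (fun y => F (φ.symm y) 1) x) +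
        kPart h (mcZ (fun y => F (φ.symm y) 1) x)
  mc_zbar : ∀ φ ∈ atlas ℂ N, ∀ x ∈ φ.target, φ.symm x ∉ S → ∀ l : Circle,
    mcZbar (fun y => F (φ.symm y) l) x =
      kPart h (mcZbar (fun y => F (φ.symm y) 1) x) +
        (l : ℂ) • pPart h (mcZbar (fun y => F (φ.symm y) 1) x)

end Surfaces

end

end UnitonLoops

/-!
The proof has three independent parts.

*The frame formula.* Since `𝓕 ∘ π` is the class of `F₁`, the map `𝔽 ∘ π` is `F₁ h F₁⁻¹` away from
the singular set `S`, and `½ 𝔽⁻¹ d𝔽` is minus the conjugate by `F₁` of the `𝔭`-part of `F₁⁻¹ dF₁`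
(`half_mcForm_conj`). Hence `Φ ∘ π` and `F_λ F₁⁻¹` satisfy the same linear system, and
`Φ(π(z), λ) F₁(z) F_λ(z)⁻¹` has vanishing derivatives (`wirtinger_quotient_eq_zero`). It is therefore
locally constant on the complement of the finite set `S`, and then constant there, because punctured
discs are connected (`eq_of_locally_constant_compl_finite`). Its value at `z₀` is `Φ(π(z₀), λ)`.

*Maximal tori and logarithms.* Both the existence of a maximal torus through `h` and the existence of
`ξ` with `exp (π ξ) = h` follow from the surjectivity of the exponential map of a compact connected
matrix group (`exists_exp_eq_of_isCompact`), applied to `G` and to the torus: the closure of a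
one-parameter group through `h` is a torus, and by Zorn's lemma it lies in a maximal one.
Surjectivity is obtained by a discrete version of the Hopf-Rinow argument. Averaging over Haar measure
gives an inner product on matrices that is invariant under conjugation. Every `g` is a product of
exponentials of elements of the Lie algebra with arbitrarily small total energy, and among such
products with a fixed number of factors there is one of minimal energy by compactness. The Gauss
lemma gives the first variation formula for short segments, and minimality then forces all factors
to coincide, so `g` is a single exponential (`IsAdInner.exp_surjective`). That elements of a closed
group near `1` are exponentials of Lie algebra elements is von Neumann's theorem
(`eventually_log_mem_expDirs`).

*The normalizing loop.* Because the center is trivial, `σ² = id` means `h² = e`, so `exp (π ξ) = h`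
gives `exp (2π ξ) = 1` and `t ↦ exp (t ξ)` factors through the circle. It is a trigonometric
polynomial, since such a `ξ` is diagonalizable with eigenvalues in `iℤ` (`exists_exp_smul_eq_sum`).
Membership of products and inverses in the loop groups is reduced to the entries: these lie in a
star-closed function algebra (the weighted Wiener algebra, or the trigonometric polynomials), and
inversion in a compact matrix group is a fixed linear expression in the conjugate transpose
(`exists_inv_eq`). By the frame formula the normalized solution is `γ(λ) F_λ F₁⁻¹`, and the identity
`F_{-λ} = h⁻¹ F_λ h` together with `γ(-λ) = γ(λ) h` makes it a fixed point of `𝕋` off the singular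
set, hence everywhere by continuity (`IsExtendedFrame.invT_eq`).
-/

namespace UnitonLoops

open NormedSpace Filter Topology

/-! ### Closed groups in a Banach algebra and their Lie algebras -/

section LieExp

variable {𝔸 : Type*} [NormedRing 𝔸] [NormedAlgebra ℝ 𝔸]

/-- The Lie algebra of a multiplicative submonoid `C` of `𝔸`: the generators of the one-parameter
groups in `C`. -/
def expDirs (C : Submonoid 𝔸) : Set 𝔸 := {X | ∀ t : ℝ, exp (t • X) ∈ C}

variable {C : Submonoid 𝔸}

lemma exp_mem_of_expDirs {X : 𝔸} (hX : X ∈ expDirs C) : exp X ∈ C := by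
  simpa using hX 1

lemma smul_mem_expDirs {X : 𝔸} (hX : X ∈ expDirs C) (s : ℝ) : s • X ∈ expDirs C := by
  intro t
  rw [smul_smul]
  exact hX _

lemma zero_mem_expDirs : (0 : 𝔸) ∈ expDirs C := by
  intro t
  simp [exp_zero, C.one_mem]

variable [CompleteSpace 𝔸]

lemma exp_add_smul (s t : ℝ) (X : 𝔸) : exp ((s + t) • X) = exp (s • X) * exp (t • X) := by
  let _ : NormedAlgebra ℚ 𝔸 := NormedAlgebra.restrictScalars ℚ ℝ 𝔸
  rw [add_smul]
  exact exp_add_of_commute (((Commute.refl X).smul_left s).smul_right t)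

lemma exp_mul_exp_neg (X : 𝔸) : exp X * exp (-X) = 1 := by
  have := exp_add_smul 1 (-1) X
  simpa using this.symm

lemma exp_neg_mul_exp (X : 𝔸) : exp (-X) * exp X = 1 := by
  have := exp_add_smul (-1) 1 X
  simpa using this.symm

lemma exp_natCast_smul (m : ℕ) (X : 𝔸) : exp ((m : ℝ) • X) = exp X ^ m := by
  let _ : NormedAlgebra ℚ 𝔸 := NormedAlgebra.restrictScalars ℚ ℝ 𝔸
  rw [← exp_nsmul, Nat.cast_smul_eq_nsmul]

lemma contDiff_exp : ContDiff ℝ ω (exp : 𝔸 → 𝔸) :=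
  contDiff_iff_contDiffAt.2 fun x => (exp_analytic (𝕂 := ℝ) x).contDiffAt

lemma continuous_exp : Continuous (exp : 𝔸 → 𝔸) := contDiff_exp.continuous

lemma hasDerivAt_exp_smul (X : 𝔸) (t : ℝ) :
    HasDerivAt (fun s : ℝ => exp (s • X)) (exp (t • X) * X) t :=
  hasDerivAt_exp_smul_const X t

lemma hasDerivAt_exp_smul_left (X : 𝔸) (t : ℝ) :
    HasDerivAt (fun s : ℝ => exp (s • X)) (X * exp (t • X)) t :=
  hasDerivAt_exp_smul_const' X t

/-- A local logarithm, continuously differentiable near `1`. -/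
lemma exists_log : ∃ L : 𝔸 → 𝔸, L 1 = 0 ∧ ContDiffAt ℝ 1 L 1 ∧
    HasStrictFDerivAt L (1 : 𝔸 →L[ℝ] 𝔸) 1 ∧
    (∀ᶠ g in 𝓝 (1 : 𝔸), exp (L g) = g) ∧ ∀ᶠ X in 𝓝 (0 : 𝔸), L (exp X) = X := by
  have h0 : HasStrictFDerivAt (exp : 𝔸 → 𝔸)
      ((ContinuousLinearEquiv.refl ℝ 𝔸 : 𝔸 ≃L[ℝ] 𝔸) : 𝔸 →L[ℝ] 𝔸) 0 :=
    hasStrictFDerivAt_exp_zero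
  have hc : ContDiffAt ℝ 1 (exp : 𝔸 → 𝔸) 0 := (contDiff_exp.of_le le_top).contDiffAt
  have e0 : exp (0 : 𝔸) = 1 := exp_zero
  refine ⟨h0.localInverse exp _ 0, ?_, ?_, ?_, ?_, h0.eventually_left_inverse⟩
  · have := h0.localInverse_apply_image
    rwa [e0] at this
  · have := hc.to_localInverse h0.hasFDerivAt one_ne_zero
    rw [e0] at this
    exact this
  · have := h0.to_localInverse
    rw [e0] at this
    exact this
  · have := h0.eventually_right_inverse
    rwa [e0] at this

lemma exp_neg_mem (hinv : ∀ a ∈ C, ∃ b ∈ C, b * a = 1) {X : 𝔸} (hX : exp X ∈ C) :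
    exp (-X) ∈ C := by
  obtain ⟨b, hb, h⟩ := hinv _ hX
  have : b = exp (-X) := left_inv_eq_right_inv h (exp_mul_exp_neg X)
  exact this ▸ hb

/-- Limits of rescaled logarithms of elements of a closed group tending to `1` are tangent to the
group. -/
lemma mem_expDirs_of_tendsto (hC : IsClosed (C : Set 𝔸)) (hinv : ∀ a ∈ C, ∃ b ∈ C, b * a = 1)
    {ι : Type*} {l : Filter ι} [l.NeBot] {Z : ι → 𝔸} {c : ι → ℝ} {X : 𝔸}
    (hZ : ∀ᶠ i in l, exp (Z i) ∈ C) (hc0 : ∀ᶠ i in l, 0 < c i) (hc : Tendsto c l (𝓝 0))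
    (hX : Tendsto (fun i => (c i)⁻¹ • Z i) l (𝓝 X)) : X ∈ expDirs C := by
  -- `exp (t X)` is the limit of the powers of `exp (Z i)` with exponents `⌊t / c i⌋`.
  have key : ∀ t : ℝ, 0 ≤ t → exp (t • X) ∈ C := by
    intro t ht
    have h1 : Tendsto (fun i => (⌊t / c i⌋₊ : ℝ) * c i) l (𝓝 t) := by
      have h2 : Tendsto (fun i => t - c i) l (𝓝 t) := by
        simpa using tendsto_const_nhds.sub hc
      refine tendsto_of_tendsto_of_tendsto_of_le_of_le' h2 tendsto_const_nhds ?_ ?_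
      · filter_upwards [hc0] with i hi
        have := (Nat.sub_one_lt_floor (t / c i)).le
        have h3 : (t / c i - 1) * c i ≤ (⌊t / c i⌋₊ : ℝ) * c i := by gcongr
        rwa [sub_mul, div_mul_cancel₀ _ hi.ne', one_mul] at h3
      · filter_upwards [hc0] with i hi
        have := Nat.floor_le (div_nonneg ht hi.le)
        calc _ ≤ t / c i * c i := by gcongr
          _ = t := div_mul_cancel₀ _ hi.ne'
    have h4 : Tendsto (fun i => exp (((⌊t / c i⌋₊ : ℝ) * c i) • ((c i)⁻¹ • Z i))) l
        (𝓝 (exp (t • X))) := (continuous_exp.tendsto _).comp (h1.smul hX)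
    refine hC.mem_of_tendsto h4 ?_
    filter_upwards [hZ, hc0] with i hi hi0
    rw [smul_smul, mul_assoc, mul_inv_cancel₀ hi0.ne', mul_one, exp_natCast_smul]
    exact C.pow_mem hi _
  intro t
  rcases le_total 0 t with ht | ht
  · exact key t ht
  · have := exp_neg_mem hinv (key (-t) (by linarith))
    simpa using this

/-- The Lie algebra is closed under addition: `X + Y` is the derivative at `0` of
`log (exp (t X) exp (t Y))`. -/
lemma add_mem_expDirs (hC : IsClosed (C : Set 𝔸)) (hinv : ∀ a ∈ C, ∃ b ∈ C, b * a = 1)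
    {X Y : 𝔸} (hX : X ∈ expDirs C) (hY : Y ∈ expDirs C) : X + Y ∈ expDirs C := by
  obtain ⟨L, hL1, -, hL, hexp, -⟩ := exists_log (𝔸 := 𝔸)
  set f : ℝ → 𝔸 := fun t => exp (t • X) * exp (t • Y) with hf
  have f0 : f 0 = 1 := by simp [hf, exp_zero]
  have hfd : HasDerivAt f (X + Y) 0 := by
    have := (hasDerivAt_exp_smul X 0).mul (hasDerivAt_exp_smul Y 0)
    simpa [exp_zero, hf, Pi.mul_def] using this
  have hd : HasDerivAt (fun t => L (f t)) (X + Y) 0 := by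
    have h1 : HasFDerivAt L (1 : 𝔸 →L[ℝ] 𝔸) (f 0) := by rw [f0]; exact hL.hasFDerivAt
    simpa [Function.comp_def] using h1.comp_hasDerivAt (0 : ℝ) hfd
  have hslope := hd.tendsto_slope_zero_right
  refine mem_expDirs_of_tendsto (l := 𝓝[>] (0 : ℝ)) (Z := fun t => L (f t)) (c := fun t => t)
    hC hinv ?_ self_mem_nhdsWithin (tendsto_nhdsWithin_of_tendsto_nhds tendsto_id) ?_
  · have : Tendsto f (𝓝[>] 0) (𝓝 1) := by
      have := hfd.continuousAt.tendsto
      rw [f0] at this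
      exact this.mono_left nhdsWithin_le_nhds
    filter_upwards [this.eventually hexp] with t ht
    rw [ht]
    exact C.mul_mem (hX t) (hY t)
  · simpa [f0, hL1] using hslope

/-- The Lie algebra of a closed group, as a real subspace. -/
def lieSub (C : Submonoid 𝔸) (hC : IsClosed (C : Set 𝔸)) (hinv : ∀ a ∈ C, ∃ b ∈ C, b * a = 1) :
    Submodule ℝ 𝔸 where
  carrier := expDirs C
  add_mem' := add_mem_expDirs hC hinv
  zero_mem' := zero_mem_expDirs
  smul_mem' := fun s _ hX => smul_mem_expDirs hX s

/-- Von Neumann's theorem: the elements of a closed group near `1` are exponentials of elements of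
its Lie algebra. -/
lemma eventually_log_mem_expDirs [FiniteDimensional ℝ 𝔸]
    (hC : IsClosed (C : Set 𝔸)) (hinv : ∀ a ∈ C, ∃ b ∈ C, b * a = 1) :
    ∀ᶠ X in 𝓝 (0 : 𝔸), exp X ∈ C → X ∈ expDirs C := by
  obtain ⟨L, hL1, -, -, -, hLexp⟩ := exists_log (𝔸 := 𝔸)
  -- With `p` a linear projection onto the Lie algebra, `φ(Z) = exp (p Z) exp (Z - p Z)` is a local
  -- diffeomorphism at `0`; `ψ` is its local inverse.
  obtain ⟨p', hp'⟩ := (lieSub C hC hinv).subtype.exists_leftInverse_of_injective (by simp)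
  set p : 𝔸 →L[ℝ] 𝔸 := LinearMap.toContinuousLinearMap ((lieSub C hC hinv).subtype ∘ₗ p') with hp
  have hpmem : ∀ Z, p Z ∈ expDirs C := fun Z => (p' Z).2
  have hpid : ∀ Z ∈ expDirs C, p Z = Z := fun Z hZ => by
    have : p' ((lieSub C hC hinv).subtype ⟨Z, hZ⟩) = ⟨Z, hZ⟩ := LinearMap.congr_fun hp' ⟨Z, hZ⟩
    exact congrArg Subtype.val this
  set φ : 𝔸 → 𝔸 := fun Z => exp (p Z) * exp (Z - p Z) with hφ
  have φ0 : φ 0 = 1 := by simp [hφ, exp_zero]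
  have hE : HasStrictFDerivAt (exp : 𝔸 → 𝔸) (1 : 𝔸 →L[ℝ] 𝔸) 0 := hasStrictFDerivAt_exp_zero
  have hφd : HasStrictFDerivAt φ
      ((ContinuousLinearEquiv.refl ℝ 𝔸 : 𝔸 ≃L[ℝ] 𝔸) : 𝔸 →L[ℝ] 𝔸) 0 := by
    have h1 : HasStrictFDerivAt (fun Z => exp (p Z)) ((1 : 𝔸 →L[ℝ] 𝔸).comp p) 0 :=
      HasStrictFDerivAt.comp (g := exp) (0 : 𝔸) (by rw [map_zero]; exact hE) p.hasStrictFDerivAt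
    have h2 : HasStrictFDerivAt (fun Z => exp (Z - p Z))
        ((1 : 𝔸 →L[ℝ] 𝔸).comp (ContinuousLinearMap.id ℝ 𝔸 - p)) 0 :=
      HasStrictFDerivAt.comp (g := exp) (0 : 𝔸) (by rw [map_zero, sub_zero]; exact hE)
        ((ContinuousLinearMap.id ℝ 𝔸 - p).hasStrictFDerivAt)
    refine (h1.mul' h2).congr_fderiv ?_
    ext Z
    simp [exp_zero]
  set ψ := hφd.localInverse φ _ 0
  have hψ0 : ψ 1 = 0 := by
    have := hφd.localInverse_apply_image
    rwa [φ0] at this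
  have hψc : Tendsto ψ (𝓝 1) (𝓝 0) := by
    have := hφd.localInverse_continuousAt
    rw [φ0, ContinuousAt] at this
    change Tendsto ψ (𝓝 1) (𝓝 (ψ 1)) at this
    rwa [hψ0] at this
  have hψr : ∀ᶠ g in 𝓝 (1 : 𝔸), φ (ψ g) = g := by
    have := hφd.eventually_right_inverse
    rwa [φ0] at this
  have hexp1 : Tendsto (exp : 𝔸 → 𝔸) (𝓝 0) (𝓝 1) := by
    simpa [exp_zero] using (continuous_exp (𝔸 := 𝔸)).tendsto 0
  have hψe : Tendsto (fun X => ψ (exp X)) (𝓝 0) (𝓝 0) := hψc.comp hexp1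
  set Y : 𝔸 → 𝔸 := fun X => ψ (exp X) - p (ψ (exp X)) with hY
  have hY0 : Tendsto Y (𝓝 0) (𝓝 0) := by
    simpa using hψe.sub ((p.continuous.tendsto 0).comp hψe)
  have hYC : ∀ᶠ X in 𝓝 (0 : 𝔸), exp X ∈ C → exp (Y X) ∈ C := by
    filter_upwards [hexp1.eventually hψr] with X hX hXC
    have h1 : exp (Y X) = exp (-p (ψ (exp X))) * exp X :=
      calc exp (Y X) = exp (-p (ψ (exp X))) * φ (ψ (exp X)) := by
            simp only [hφ]
            rw [← mul_assoc, exp_neg_mul_exp, one_mul]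
        _ = _ := by rw [hX]
    rw [h1]
    exact C.mul_mem (exp_neg_mem hinv (exp_mem_of_expDirs (hpmem _))) hXC
  -- The component transverse to the Lie algebra vanishes: otherwise its direction would
  -- accumulate at a unit tangent vector outside the Lie algebra.
  have hYz : ∀ᶠ X in 𝓝 (0 : 𝔸), exp X ∈ C → Y X = 0 := by
    by_contra hcon
    have hne : (𝓝 (0 : 𝔸) ⊓ 𝓟 {X | exp X ∈ C ∧ Y X ≠ 0}).NeBot := by
      rw [← frequently_mem_iff_neBot]
      refine (not_eventually.1 hcon).mono fun X hX => ?_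
      exact Classical.not_imp.1 hX
    set l := Ultrafilter.of (𝓝 (0 : 𝔸) ⊓ 𝓟 {X | exp X ∈ C ∧ Y X ≠ 0}) with hl
    have hl0 : (l : Filter 𝔸) ≤ 𝓝 0 := (Ultrafilter.of_le _).trans inf_le_left
    have hlP : ∀ᶠ X in (l : Filter 𝔸), exp X ∈ C ∧ Y X ≠ 0 :=
      le_principal_iff.1 ((Ultrafilter.of_le _).trans inf_le_right)
    have hsph : ((l.map fun X => ‖Y X‖⁻¹ • Y X : Ultrafilter 𝔸) : Filter 𝔸) ≤
        𝓟 (Metric.sphere (0 : 𝔸) 1) := by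
      rw [le_principal_iff]
      change ∀ᶠ X in (l : Filter 𝔸), ‖Y X‖⁻¹ • Y X ∈ Metric.sphere (0 : 𝔸) 1
      filter_upwards [hlP] with X hX
      rw [mem_sphere_zero_iff_norm, norm_smul, norm_inv, norm_norm,
        inv_mul_cancel₀ (norm_ne_zero_iff.2 hX.2)]
    have : ProperSpace 𝔸 := FiniteDimensional.proper ℝ 𝔸
    obtain ⟨y, hy1, hy⟩ := (isCompact_sphere (0 : 𝔸) 1).ultrafilter_le_nhds _ hsph
    have hty : Tendsto (fun X => ‖Y X‖⁻¹ • Y X) (l : Filter 𝔸) (𝓝 y) := hy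
    have hyC : y ∈ expDirs C := by
      refine mem_expDirs_of_tendsto hC hinv (Z := Y) (c := fun X => ‖Y X‖) ?_ ?_ ?_ hty
      · filter_upwards [hlP, hl0 hYC] with X h1 h2 using h2 h1.1
      · filter_upwards [hlP] with X h1 using norm_pos_iff.2 h1.2
      · simpa using (hY0.mono_left hl0).norm
    have hpy : p y = 0 := by
      have h1 : Tendsto (fun X => p (‖Y X‖⁻¹ • Y X)) (l : Filter 𝔸) (𝓝 (p y)) :=
        (p.continuous.tendsto y).comp hty
      refine tendsto_nhds_unique h1 (tendsto_const_nhds.congr fun X => ?_)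
      rw [map_smul, hY]
      simp [hpid _ (hpmem _)]
    have : y = 0 := (hpid y hyC).symm.trans hpy
    rw [this] at hy1
    simp at hy1
  filter_upwards [hYz, hLexp, hexp1.eventually hψr, hψe.eventually hLexp] with X h1 h2 h3 h4 hX
  have h5 : ψ (exp X) = p (ψ (exp X)) := sub_eq_zero.1 (h1 hX)
  have h6 : exp (ψ (exp X)) = exp X := by
    have h7 : φ (ψ (exp X)) = exp (ψ (exp X)) := by
      simp only [hφ]
      rw [← h5, sub_self, exp_zero, mul_one]
    rw [← h7, h3]
  have h8 : X = ψ (exp X) := by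
    rw [← h2, ← h6, h4, h6]
  rw [h8, h5]
  exact hpmem _

end LieExp

/-! ### The Gauss lemma and the first variation of energy -/

section LieExp

variable {𝔸 : Type*} [NormedRing 𝔸] [NormedAlgebra ℝ 𝔸] [CompleteSpace 𝔸] {C : Submonoid 𝔸}

/-- An inner product on `𝔸` that is invariant under the adjoint action of the one-parameter
groups in `C`. -/
structure IsAdInner (C : Submonoid 𝔸) (B : 𝔸 →L[ℝ] 𝔸 →L[ℝ] ℝ) : Prop where
  symm : ∀ X Y, B X Y = B Y X
  pos : ∀ X, X ≠ 0 → 0 < B X X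
  inv : ∀ X ∈ expDirs C, ∀ Y Z, B (exp X * Y * exp (-X)) (exp X * Z * exp (-X)) = B Y Z

variable {B : 𝔸 →L[ℝ] 𝔸 →L[ℝ] ℝ}

lemma exp_mul_self_mul_exp_neg (X : 𝔸) : exp X * X * exp (-X) = X := by
  have h : exp X * X = X * exp X := by
    have := (hasDerivAt_exp_smul X 1).unique (hasDerivAt_exp_smul_left X 1)
    simpa using this
  rw [h, mul_assoc, exp_mul_exp_neg, mul_one]

/-- Pairing with `X` is unchanged by conjugation with the one-parameter group of `X`, which fixes
`X`. -/
lemma IsAdInner.apply_conj (hB : IsAdInner C B) {X : 𝔸} (hX : X ∈ expDirs C) (V : 𝔸) (s : ℝ) :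
    B X (exp (s • X) * V * exp (-(s • X))) = B X V := by
  have h1 : exp (s • X) * X * exp (-(s • X)) = X := by
    rcases eq_or_ne s 0 with rfl | hs
    · simp [exp_zero]
    · have := congrArg (fun Y => s⁻¹ • Y) (exp_mul_self_mul_exp_neg (s • X))
      simpa [smul_smul, inv_mul_cancel₀ hs] using this
  have := hB.inv _ (smul_mem_expDirs hX s) X V
  rwa [h1] at this

/-- The Gauss lemma: the differential of the exponential map at `X` preserves inner products
with the radial direction `X`. For fixed small `t`, the function
`s ↦ ⟨X, exp (s (X + t V)) exp (-s X)⟩ - s t ⟨X, V⟩` has derivative `t F(t, s)` with `F(0, s) = 0`, so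
its increment over `[0, 1]` is `o(t)`. -/
lemma IsAdInner.gauss (hB : IsAdInner C B) {X : 𝔸} (hX : X ∈ expDirs C) {D : 𝔸 →L[ℝ] 𝔸}
    (hD : HasFDerivAt (exp : 𝔸 → 𝔸) D X) (V : 𝔸) : B X (D V * exp (-X)) = B X V := by
  set F : ℝ → ℝ → ℝ := fun t s =>
    B X ((exp (s • (X + t • V)) * exp (-(s • X)) - 1) * (exp (s • X) * V * exp (-(s • X)))) with hF
  have hFc : Continuous (fun q : ℝ × ℝ => F q.1 q.2) := by
    have := continuous_exp (𝔸 := 𝔸)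
    fun_prop
  set f : ℝ → ℝ := fun t => B X (exp (X + t • V) * exp (-X)) - t * B X V with hf
  have hf1 : HasDerivAt f (B X (D V * exp (-X)) - B X V) 0 := by
    have h1 : HasDerivAt (fun t : ℝ => X + t • V) V 0 := by
      simpa using ((hasDerivAt_id (0 : ℝ)).smul_const V).const_add X
    have h2 : HasDerivAt (fun t : ℝ => exp (X + t • V)) (D V) 0 :=
      HasFDerivAt.comp_hasDerivAt (l := exp) (0 : ℝ) (by simpa using hD) h1
    have h3 := ((B X).hasFDerivAt.comp_hasDerivAt (0 : ℝ) (h2.mul_const (exp (-X)))).sub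
      ((hasDerivAt_id (0 : ℝ)).mul_const (B X V))
    simpa [hf, Function.comp_def, Pi.sub_def] using h3
  have hf2 : HasDerivAt f 0 0 := by
    rw [hasDerivAt_iff_isLittleO_nhds_zero, Asymptotics.isLittleO_iff]
    intro ε hε
    have hev : ∀ᶠ t in 𝓝 (0 : ℝ), ∀ s ∈ Set.Icc (0 : ℝ) 1, |F t s| < ε := by
      refine isCompact_Icc.eventually_forall_of_forall_eventually fun s _ => ?_
      have h1 : F 0 s = 0 := by simp [hF, exp_mul_exp_neg]
      have h2 : Tendsto (fun q : ℝ × ℝ => |F q.1 q.2|) (𝓝 (0, s)) (𝓝 0) := by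
        have := (hFc.abs).tendsto (0, s)
        simpa [h1] using this
      exact h2.eventually (gt_mem_nhds hε)
    filter_upwards [hev] with t ht
    have hd : ∀ s : ℝ, HasDerivAt
        (fun s : ℝ => B X (exp (s • (X + t • V)) * exp (s • (-X))) - s * (t * B X V))
        (t * F t s) s := by
      intro s
      have h1 := (hasDerivAt_exp_smul (X + t • V) s).mul (hasDerivAt_exp_smul_left (-X) s)
      have h2 := ((B X).hasFDerivAt.comp_hasDerivAt s h1).sub
        ((hasDerivAt_id s).mul_const (t * B X V))
      refine h2.congr_deriv ?_
      have h3 : exp (s • (X + t • V)) * (X + t • V) * exp (s • -X) +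
          exp (s • (X + t • V)) * (-X * exp (s • -X)) =
          t • (exp (s • (X + t • V)) * V * exp (-(s • X))) := by
        rw [smul_neg]
        simp only [mul_add, add_mul, mul_smul_comm, smul_mul_assoc, neg_mul, mul_neg, mul_assoc]
        abel
      have h4 : exp (s • (X + t • V)) * V * exp (-(s • X)) =
          (exp (s • (X + t • V)) * exp (-(s • X)) - 1) * (exp (s • X) * V * exp (-(s • X))) +
          exp (s • X) * V * exp (-(s • X)) := by
        rw [sub_mul, one_mul, sub_add_cancel]
        simp only [← mul_assoc]
        rw [mul_assoc (exp (s • (X + t • V))) (exp (-(s • X))), exp_neg_mul_exp, mul_one]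
      rw [h3, map_smul, h4, map_add, hB.apply_conj hX]
      simp only [hF, smul_eq_mul, one_mul]
      ring
    have hb := norm_image_sub_le_of_norm_deriv_le_segment_01' (C := |t| * ε)
      (fun s hs => (hd s).hasDerivWithinAt) (fun s hs => by
        rw [Real.norm_eq_abs, abs_mul]
        exact mul_le_mul_of_nonneg_left (ht s ⟨hs.1, hs.2.le⟩).le (abs_nonneg t))
    have e1 : f (0 + t) - f 0 - t • (0 : ℝ) =
        B X (exp ((1 : ℝ) • (X + t • V)) * exp ((1 : ℝ) • (-X))) - 1 * (t * B X V) -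
        (B X (exp ((0 : ℝ) • (X + t • V)) * exp ((0 : ℝ) • (-X))) - 0 * (t * B X V)) := by
      simp [hf, exp_zero, exp_mul_exp_neg]
    rw [e1, mul_comm ε, Real.norm_eq_abs t]
    exact hb
  exact sub_eq_zero.1 (hf1.unique hf2)

/-- The first variation of energy: moving the endpoint of a short one-parameter segment `X` in the
direction `W` changes its squared length at the rate `2 ⟨X, W⟩`. The new segment is
`Z(t) = log (exp X exp (t W))`, and the rate follows from the Gauss lemma. -/
lemma IsAdInner.first_variation [FiniteDimensional ℝ 𝔸] (hB : IsAdInner C B)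
    (hC : IsClosed (C : Set 𝔸)) (hinv : ∀ a ∈ C, ∃ b ∈ C, b * a = 1) :
    ∀ᶠ X in 𝓝 (0 : 𝔸), X ∈ expDirs C → ∀ W ∈ expDirs C, ∃ Z : ℝ → 𝔸, Z 0 = X ∧
      (∀ᶠ t in 𝓝 (0 : ℝ), Z t ∈ expDirs C ∧ exp (Z t) = exp X * exp (t • W)) ∧
      HasDerivAt (fun t => B (Z t) (Z t)) (2 * B X W) 0 := by
  obtain ⟨L, hL1, hLc, -, hexp, hLexp⟩ := exists_log (𝔸 := 𝔸)
  have hexp1 : Tendsto (exp : 𝔸 → 𝔸) (𝓝 0) (𝓝 1) := by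
    simpa [exp_zero] using (continuous_exp (𝔸 := 𝔸)).tendsto 0
  filter_upwards [hLexp, hexp1.eventually (hLc.eventually (by simp)),
    hexp1.eventually hexp.eventually_nhds,
    (eventually_log_mem_expDirs hC hinv).eventually_nhds] with X h1 h2 h3 h4 hX W hW
  set f : ℝ → 𝔸 := fun t => exp X * exp (t • W) with hf
  have hf0 : f 0 = exp X := by simp [hf, exp_zero]
  have hfd : HasDerivAt f (exp X * W) 0 := by
    simpa [exp_zero] using (hasDerivAt_exp_smul W 0).const_mul (exp X)
  have hfc : Tendsto f (𝓝 0) (𝓝 (exp X)) := by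
    simpa [hf0] using hfd.continuousAt.tendsto
  set Z : ℝ → 𝔸 := fun t => L (f t) with hZ
  have hZ0 : Z 0 = X := by simp only [hZ, hf0, h1]
  have hLd : HasFDerivAt L (fderiv ℝ L (f 0)) (f 0) := by
    rw [hf0]
    exact (h2.differentiableAt one_ne_zero).hasFDerivAt
  have hZd : HasDerivAt Z (fderiv ℝ L (f 0) (exp X * W)) 0 := hLd.comp_hasDerivAt (0 : ℝ) hfd
  have hZc : Tendsto Z (𝓝 0) (𝓝 X) := by
    simpa [hZ0] using hZd.continuousAt.tendsto
  have hZe : ∀ᶠ t in 𝓝 (0 : ℝ), exp (Z t) = f t := hfc.eventually h3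
  refine ⟨Z, hZ0, ?_, ?_⟩
  · filter_upwards [hZe, hZc.eventually h4] with t h5 h6
    refine ⟨h6 ?_, h5⟩
    rw [h5]
    exact C.mul_mem (exp_mem_of_expDirs hX) (hW t)
  · set V := fderiv ℝ L (f 0) (exp X * W)
    have hD : HasFDerivAt (exp : 𝔸 → 𝔸) (fderiv ℝ exp X) X :=
      (contDiff_exp.differentiable (by simp) X).hasFDerivAt
    have h7 : fderiv ℝ exp X V = exp X * W := by
      have h8 : HasDerivAt (fun t => exp (Z t)) (fderiv ℝ exp X V) 0 :=
        HasFDerivAt.comp_hasDerivAt (l := exp) (0 : ℝ) (by rw [hZ0]; exact hD) hZd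
      exact h8.unique (hfd.congr_of_eventuallyEq hZe)
    have h9 : B X V = B X W := by
      rw [← hB.gauss hX hD V, h7]
      simpa using hB.apply_conj hX W 1
    have h10 := (B.hasFDerivAt.comp_hasDerivAt (0 : ℝ) hZd).clm_apply hZd
    refine h10.congr_deriv ?_
    simp only [Function.comp_apply, hZ0]
    rw [hB.symm V X, h9]
    ring

end LieExp

/-! ### Surjectivity of the exponential map -/

section LieExp

variable {𝔸 : Type*} [NormedRing 𝔸] [NormedAlgebra ℝ 𝔸] {C : Submonoid 𝔸}
  {B : 𝔸 →L[ℝ] 𝔸 →L[ℝ] ℝ}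

/-- An inner product on a finite-dimensional algebra dominates a multiple of the square of the
norm. -/
lemma IsAdInner.exists_lower_bound [FiniteDimensional ℝ 𝔸] (hB : IsAdInner C B) :
    ∃ c > 0, ∀ X, c * ‖X‖ ^ 2 ≤ B X X := by
  have : ProperSpace 𝔸 := FiniteDimensional.proper ℝ 𝔸
  have hcont : Continuous fun X => B X X := by fun_prop
  rcases (Metric.sphere (0 : 𝔸) 1).eq_empty_or_nonempty with he | hne
  · refine ⟨1, one_pos, fun X => ?_⟩
    have : X = 0 := by
      by_contra hX
      have : ‖X‖⁻¹ • X ∈ Metric.sphere (0 : 𝔸) 1 := by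
        rw [mem_sphere_zero_iff_norm, norm_smul, norm_inv, norm_norm,
          inv_mul_cancel₀ (norm_ne_zero_iff.2 hX)]
      rw [he] at this
      exact this
    simp [this]
  · obtain ⟨Y, hY, hmin⟩ := (isCompact_sphere (0 : 𝔸) 1).exists_isMinOn hne hcont.continuousOn
    refine ⟨B Y Y, hB.pos Y fun h => by simp [h] at hY, fun X => ?_⟩
    rcases eq_or_ne X 0 with rfl | hX
    · simp
    have hX' : 0 < ‖X‖ := norm_pos_iff.2 hX
    have h1 : ‖X‖⁻¹ • X ∈ Metric.sphere (0 : 𝔸) 1 := by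
      rw [mem_sphere_zero_iff_norm, norm_smul, norm_inv, norm_norm, inv_mul_cancel₀ hX'.ne']
    have h2 := isMinOn_iff.1 hmin _ h1
    simp only [map_smul, smul_eq_mul, _root_.smul_apply] at h2
    calc B Y Y * ‖X‖ ^ 2 ≤ ‖X‖⁻¹ * (‖X‖⁻¹ * B X X) * ‖X‖ ^ 2 := by gcongr
      _ = B X X := by field_simp

variable [CompleteSpace 𝔸]

/-- Every element of a connected closed group is a product of exponentials of total energy as small
as one likes: subdividing a one-parameter segment into `N` pieces divides its energy by `N`. -/
lemma exists_chain_of_small_energy [FiniteDimensional ℝ 𝔸] (hC : IsClosed (C : Set 𝔸))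
    (hconn : IsPreconnected (C : Set 𝔸)) (hinv : ∀ a ∈ C, ∃ b ∈ C, b * a = 1)
    {g : 𝔸} (hg : g ∈ C) {δ : ℝ} (hδ : 0 < δ) :
    ∃ l : List 𝔸, (∀ X ∈ l, X ∈ expDirs C) ∧ (l.map exp).prod = g ∧
      (l.map fun X => B X X).sum ≤ δ := by
  -- `P x y`: chains of arbitrarily small energy lead from `x` to `y`.
  let P : 𝔸 → 𝔸 → Prop := fun x y => ∀ δ : ℝ, 0 < δ → ∃ l : List 𝔸, (∀ X ∈ l, X ∈ expDirs C) ∧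
      x * (l.map exp).prod = y ∧ (l.map fun X => B X X).sum ≤ δ
  have hseg : ∀ (x Z : 𝔸), Z ∈ expDirs C → P x (x * exp Z) := by
    intro x Z hZ δ hδ
    obtain ⟨N, hN⟩ := exists_nat_gt (B Z Z / δ)
    have hN1 : (0 : ℝ) < (N + 1 : ℕ) := by positivity
    refine ⟨List.replicate (N + 1) (((N + 1 : ℕ) : ℝ)⁻¹ • Z), fun X hX => ?_, ?_, ?_⟩
    · rw [List.eq_of_mem_replicate hX]
      exact smul_mem_expDirs hZ _
    · rw [List.map_replicate, List.prod_replicate, ← exp_natCast_smul, smul_smul,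
        mul_inv_cancel₀ hN1.ne', one_smul]
    · rw [List.map_replicate, List.sum_replicate, nsmul_eq_mul]
      simp only [map_smul, smul_eq_mul, _root_.smul_apply]
      rw [← mul_assoc, mul_inv_cancel₀ hN1.ne', one_mul, inv_mul_le_iff₀ hN1]
      have h1 : B Z Z < N * δ := (div_lt_iff₀ hδ).1 hN
      push_cast
      nlinarith
  have htrans : ∀ x y z : 𝔸, P x y → P y z → P x z := by
    intro x y z h1 h2 δ hδ
    obtain ⟨l₁, h11, h12, h13⟩ := h1 (δ / 2) (by positivity)
    obtain ⟨l₂, h21, h22, h23⟩ := h2 (δ / 2) (by positivity)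
    refine ⟨l₁ ++ l₂, fun X hX => ?_, ?_, ?_⟩
    · rcases List.mem_append.1 hX with h | h
      exacts [h11 _ h, h21 _ h]
    · rw [List.map_append, List.prod_append, ← mul_assoc, h12, h22]
    · rw [List.map_append, List.sum_append]
      linarith
  obtain ⟨L, hL1, hLc, -, hexp, -⟩ := exists_log (𝔸 := 𝔸)
  have hL0 : Tendsto L (𝓝 1) (𝓝 0) := by
    simpa [ContinuousAt, hL1] using hLc.continuousAt
  have hloc : ∀ x ∈ (C : Set 𝔸), ∀ᶠ y in 𝓝[(C : Set 𝔸)] x, P x y ∧ P y x := by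
    intro x hx
    obtain ⟨b, hb, hbx⟩ := hinv x hx
    obtain ⟨c, -, hcb⟩ := hinv b hb
    have hxb : x * b = 1 := by
      have : c = x := left_inv_eq_right_inv hcb hbx
      rw [← this, hcb]
    have ht : Tendsto (fun y => b * y) (𝓝[(C : Set 𝔸)] x) (𝓝 1) := by
      rw [← hbx]
      exact ((continuous_const_mul b).tendsto x).mono_left nhdsWithin_le_nhds
    filter_upwards [self_mem_nhdsWithin, ht.eventually hexp,
      ht.eventually (hL0.eventually (eventually_log_mem_expDirs hC hinv))] with y hy h1 h2
    obtain ⟨Z, hZ, e1⟩ : ∃ Z ∈ expDirs C, y = x * exp Z :=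
      ⟨L (b * y), h2 (by rw [h1]; exact C.mul_mem hb hy), by rw [h1, ← mul_assoc, hxb, one_mul]⟩
    have e2 : x = y * exp (-Z) := by rw [e1, mul_assoc, exp_mul_exp_neg, mul_one]
    refine ⟨e1 ▸ hseg x Z hZ, ?_⟩
    have h3 := hseg y _ (smul_mem_expDirs hZ (-1))
    rwa [neg_one_smul, ← e2] at h3
  have := hconn.induction₂' P hloc (fun x y z _ _ _ => htrans x y z) C.one_mem hg δ hδ
  simpa using this

/-- The exponential map of a compact connected group with an invariant inner product is surjective.
A chain of `m` short one-parameter segments from `1` to `g` of minimal energy is critical; by the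
first variation formula consecutive segments coincide, so that `g` is the exponential of `m` times
their common generator. -/
theorem IsAdInner.exp_surjective [FiniteDimensional ℝ 𝔸] (hB : IsAdInner C B)
    (hC : IsCompact (C : Set 𝔸)) (hconn : IsPreconnected (C : Set 𝔸))
    (hinv : ∀ a ∈ C, ∃ b ∈ C, b * a = 1) {g : 𝔸} (hg : g ∈ C) :
    ∃ X ∈ expDirs C, exp X = g := by
  have hprop : ProperSpace 𝔸 := FiniteDimensional.proper ℝ 𝔸
  have hE : Continuous (exp : 𝔸 → 𝔸) := continuous_exp
  obtain ⟨c, hc, hlow⟩ := hB.exists_lower_bound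
  obtain ⟨r, hr, hball⟩ := Metric.eventually_nhds_iff.1 (hB.first_variation hC.isClosed hinv)
  obtain ⟨δ, hδ0, hδ1, hδr⟩ : ∃ δ : ℝ, 0 < δ ∧ δ < 1 ∧ δ < c * r ^ 2 := by
    have : 0 < min 1 (c * r ^ 2) := lt_min one_pos (by positivity)
    exact ⟨min 1 (c * r ^ 2) / 2, by positivity,
      (half_lt_self this).trans_le (min_le_left _ _), (half_lt_self this).trans_le (min_le_right _ _)⟩
  have hnn : ∀ X, 0 ≤ B X X := fun X => le_trans (by positivity) (hlow X)
  obtain ⟨l, hl1, hl2, hl3⟩ := exists_chain_of_small_energy (B := B) hC.isClosed hconn hinv hg hδ0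
  set m := l.length with hm
  -- Chains of `m` segments: `q.1 i` is the `i`-th vertex and `q.2 i` the generator of the segment
  -- that starts there.
  -- `D` bounds the generators to make the space `K` of chains from `1` to `g` compact. The bound is
  -- harmless: the minimal chain has energy at most `δ < 1`. The condition `δ < c r²` makes its
  -- segments short enough for the first variation formula.
  set D : Set 𝔸 := expDirs C ∩ {X | B X X ≤ 1} with hD
  set K : Set ((ℕ → 𝔸) × (ℕ → 𝔸)) := ((Set.univ.pi fun _ => (C : Set 𝔸)) ×ˢ (Set.univ.pi fun _ => D)) ∩
    {q | q.1 0 = 1 ∧ q.1 m = g ∧ ∀ i, i < m → q.1 (i + 1) = q.1 i * exp (q.2 i)} with hK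
  set E : (ℕ → 𝔸) × (ℕ → 𝔸) → ℝ := fun q => ∑ i ∈ Finset.range m, B (q.2 i) (q.2 i) with hEdef
  have hDc : IsCompact D := by
    refine (isCompact_closedBall (0 : 𝔸) (Real.sqrt (1 / c))).of_isClosed_subset ?_ ?_
    · refine IsClosed.inter ?_ (isClosed_le (by fun_prop) continuous_const)
      have : expDirs C = ⋂ t : ℝ, (fun X => exp (t • X)) ⁻¹' (C : Set 𝔸) := by
        ext X
        simp [expDirs]
      rw [this]
      exact isClosed_iInter fun t => hC.isClosed.preimage (by fun_prop)
    · rintro X ⟨-, hX⟩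
      rw [mem_closedBall_zero_iff]
      refine Real.le_sqrt_of_sq_le ?_
      rw [le_div_iff₀ hc]
      have : B X X ≤ 1 := hX
      linarith [hlow X]
  have hKc : IsCompact K := by
    refine ((isCompact_univ_pi fun _ => hC).prod (isCompact_univ_pi fun _ => hDc)).inter_right ?_
    simp only [Set.ofPred_and, Set.ofPred_forall]
    refine (isClosed_eq (by fun_prop) continuous_const).inter
      ((isClosed_eq (by fun_prop) continuous_const).inter ?_)
    exact isClosed_iInter fun i => isClosed_iInter fun _ => isClosed_eq (by fun_prop) (by fun_prop)
  have hpm : ∀ l' : List 𝔸, (∀ X ∈ l', X ∈ expDirs C) → (l'.map exp).prod ∈ C := by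
    intro l' hl'
    refine C.list_prod_mem fun x hx => ?_
    obtain ⟨X, hX, rfl⟩ := List.mem_map.1 hx
    exact exp_mem_of_expDirs (hl' X hX)
  set q₀ : (ℕ → 𝔸) × (ℕ → 𝔸) := (fun i => ((l.take i).map exp).prod, fun i => l.getD i 0) with hq₀
  have hsumlist : ∀ l' : List 𝔸, ∑ i ∈ Finset.range l'.length, B (l'.getD i 0) (l'.getD i 0) =
      (l'.map fun X => B X X).sum := by
    intro l'
    induction l' with
    | nil => simp
    | cons a t ih =>
      rw [List.length_cons, Finset.sum_range_succ']
      simp only [List.getD_cons_succ, List.getD_cons_zero, List.map_cons, List.sum_cons]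
      rw [ih, add_comm]
  have hq₀E : E q₀ ≤ δ := by
    rw [hEdef, hq₀, hm]
    exact (hsumlist l).le.trans hl3
  have hgetD : ∀ i, l.getD i 0 ∈ expDirs C := by
    intro i
    rcases lt_or_ge i l.length with hi | hi
    · rw [List.getD_eq_getElem _ _ hi]
      exact hl1 _ (List.getElem_mem hi)
    · rw [List.getD_eq_default _ _ hi]
      exact zero_mem_expDirs
  have hterm : ∀ q : (ℕ → 𝔸) × (ℕ → 𝔸), ∀ i < m, B (q.2 i) (q.2 i) ≤ E q := fun q i hi =>
    Finset.single_le_sum (f := fun i => B (q.2 i) (q.2 i)) (fun j _ => hnn _) (Finset.mem_range.2 hi)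
  have hq₀K : q₀ ∈ K := by
    refine ⟨⟨fun i _ => hpm _ fun X hX => hl1 _ (List.mem_of_mem_take hX), fun i _ => ⟨hgetD i, ?_⟩⟩,
      by simp [hq₀], ?_, fun i hi => ?_⟩
    · rcases lt_or_ge i m with hi | hi
      · exact (hterm q₀ i hi).trans (hq₀E.trans hδ1.le)
      · change B (l.getD i 0) (l.getD i 0) ≤ 1
        rw [List.getD_eq_default _ _ hi]
        simp
    · change ((l.take l.length).map exp).prod = g
      rw [List.take_length, hl2]
    · simp only [hq₀]
      rw [List.take_add_one, List.getD_eq_getElem _ _ hi, List.getElem?_eq_getElem hi,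
        Option.toList_some, List.map_append, List.prod_append, List.map_singleton,
        List.prod_singleton]
  obtain ⟨⟨a, X⟩, hqK, hqmin⟩ := hKc.exists_isMinOn ⟨q₀, hq₀K⟩
    (f := E) (Continuous.continuousOn (by rw [hEdef]; fun_prop))
  have hEle : E (a, X) ≤ δ := (isMinOn_iff.1 hqmin q₀ hq₀K).trans hq₀E
  obtain ⟨⟨haC, hXD⟩, ha0, ham, hstep⟩ := hqK
  simp only at ha0 ham hstep haC hXD
  have hXe : ∀ i, X i ∈ expDirs C := fun i => (hXD i trivial).1
  have hsmall : ∀ i < m, ‖X i‖ < r := by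
    intro i hi
    have h1 := (hlow (X i)).trans ((hterm (a, X) i hi).trans hEle)
    have h2 : ‖X i‖ ^ 2 < r ^ 2 := lt_of_mul_lt_mul_left (h1.trans_lt hδr) hc.le
    exact lt_of_pow_lt_pow_left₀ 2 hr.le h2
  -- Moving the vertex `j + 1` in the direction `W = X j - X (j + 1)` changes the energy at the rate
  -- `2 ⟨X j, W⟩ - 2 ⟨X (j + 1), W⟩ = 2 ⟨W, W⟩`, which vanishes by minimality.
  have hcons : ∀ j, j + 1 < m → X j = X (j + 1) := by
    intro j hj
    set W := X j - X (j + 1) with hW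
    have hnegm : ∀ Y ∈ expDirs C, -Y ∈ expDirs C := fun Y hY => by
      simpa using smul_mem_expDirs hY (-1)
    have hWm : W ∈ expDirs C := by
      rw [hW, sub_eq_add_neg]
      exact add_mem_expDirs hC.isClosed hinv (hXe j) (hnegm _ (hXe (j + 1)))
    obtain ⟨Z, hZ0, hZ, hZd⟩ := hball (by simpa using hsmall j (by omega)) (hXe j) W hWm
    obtain ⟨Z', hZ'0, hZ', hZ'd⟩ := hball (y := -X (j + 1)) (by simpa using hsmall (j + 1) hj)
      (hnegm _ (hXe (j + 1))) W hWm
    have hlt : ∀ i < m, B (X i) (X i) < 1 := fun i hi =>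
      ((hterm (a, X) i hi).trans hEle).trans_lt hδ1
    have hb : ∀ᶠ t in 𝓝 (0 : ℝ), B (Z t) (Z t) < 1 :=
      hZd.continuousAt.eventually (gt_mem_nhds (by simpa [hZ0] using hlt j (by omega)))
    have hb' : ∀ᶠ t in 𝓝 (0 : ℝ), B (Z' t) (Z' t) < 1 :=
      hZ'd.continuousAt.eventually (gt_mem_nhds (by simpa [hZ'0] using hlt (j + 1) hj))
    have hjj : j ≠ j + 1 := by omega
    have hmin : IsLocalMin (fun t => B (Z t) (Z t) + B (Z' t) (Z' t)) 0 := by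
      filter_upwards [hZ, hZ', hb, hb'] with t h1 h2 h3 h4
      set a' : ℕ → 𝔸 := Function.update a (j + 1) (a (j + 1) * exp (t • W)) with ha'
      set X' : ℕ → 𝔸 := Function.update (Function.update X j (Z t)) (j + 1) (-Z' t) with hX'
      have hX'j : X' j = Z t := by
        rw [hX', Function.update_of_ne hjj, Function.update_self]
      have hX'j1 : X' (j + 1) = -Z' t := by rw [hX', Function.update_self]
      have hX'i : ∀ i, i ≠ j → i ≠ j + 1 → X' i = X i := fun i hi hi' => by
        rw [hX', Function.update_of_ne hi', Function.update_of_ne hi]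
      have ha'j1 : a' (j + 1) = a (j + 1) * exp (t • W) := by rw [ha', Function.update_self]
      have ha'i : ∀ i, i ≠ j + 1 → a' i = a i := fun i hi => by
        rw [ha', Function.update_of_ne hi]
      have hK' : (a', X') ∈ K := by
        refine ⟨⟨fun i _ => ?_, fun i _ => ?_⟩, ?_, ?_, fun i hi => ?_⟩
        · rcases eq_or_ne i (j + 1) with rfl | hi
          · change a' (j + 1) ∈ C
            rw [ha'j1]
            exact C.mul_mem (haC _ trivial) (hWm t)
          · change a' i ∈ C
            rw [ha'i i hi]
            exact haC _ trivial
        · change X' i ∈ D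
          rcases eq_or_ne i (j + 1) with rfl | hi
          · rw [hX'j1]
            exact ⟨hnegm _ h2.1, by simpa using h4.le⟩
          · rcases eq_or_ne i j with rfl | hi'
            · rw [hX'j]
              exact ⟨h1.1, h3.le⟩
            · rw [hX'i i hi' hi]
              exact hXD i trivial
        · change a' 0 = 1
          rw [ha'i 0 (by omega), ha0]
        · change a' m = g
          rw [ha'i m (by omega), ham]
        · change a' (i + 1) = a' i * exp (X' i)
          rcases eq_or_ne i (j + 1) with rfl | hi1
          · have h5 : exp (-Z' t) = exp (-(t • W)) * exp (X (j + 1)) := by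
              refine left_inv_eq_right_inv (exp_neg_mul_exp (Z' t)) ?_
              rw [h2.2, mul_assoc, ← mul_assoc (exp (t • W)), exp_mul_exp_neg, one_mul,
                exp_neg_mul_exp]
            rw [ha'i _ (by omega), ha'j1, hX'j1, hstep _ hi, h5, mul_assoc,
              ← mul_assoc (exp (t • W)), exp_mul_exp_neg, one_mul]
          · rcases eq_or_ne i j with rfl | hi2
            · rw [ha'j1, ha'i i hi1, hX'j, hstep i hi, h1.2, mul_assoc]
            · rw [ha'i _ (by omega), ha'i i hi1, hX'i i hi2 hi1, hstep i hi]
      have hle : E (a, X) ≤ E (a', X') := isMinOn_iff.1 hqmin _ hK'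
      have hsplit : ∀ Y : ℕ → 𝔸, ∑ i ∈ Finset.range m, B (Y i) (Y i) =
          B (Y j) (Y j) + (B (Y (j + 1)) (Y (j + 1)) +
            ∑ i ∈ ((Finset.range m).erase j).erase (j + 1), B (Y i) (Y i)) := by
        intro Y
        rw [Finset.add_sum_erase _ (fun i => B (Y i) (Y i)), Finset.add_sum_erase _ (fun i => B (Y i) (Y i))]
        · exact Finset.mem_range.2 (by omega)
        · exact Finset.mem_erase.2 ⟨hjj.symm, Finset.mem_range.2 hj⟩
      have hrest : ∑ i ∈ ((Finset.range m).erase j).erase (j + 1), B (X' i) (X' i) =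
          ∑ i ∈ ((Finset.range m).erase j).erase (j + 1), B (X i) (X i) := by
        refine Finset.sum_congr rfl fun i hi => ?_
        have h6 := Finset.mem_erase.1 hi
        rw [hX'i i (Finset.mem_erase.1 h6.2).1 h6.1]
      simp only [hEdef] at hle
      rw [hsplit X, hsplit X', hrest, hX'j, hX'j1] at hle
      simp only [map_neg, _root_.neg_apply, neg_neg] at hle
      rw [hZ0, hZ'0]
      simp only [map_neg, _root_.neg_apply, neg_neg]
      linarith
    have h7 := hmin.hasDerivAt_eq_zero (hZd.add hZ'd)
    have h8 : B W W = 0 := by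
      have : B W W = B (X j) W + B (-X (j + 1)) W := by
        rw [← _root_.add_apply, ← map_add, hW, sub_eq_add_neg]
      linarith
    by_contra hne
    exact (hB.pos W (sub_ne_zero.2 hne)).ne' h8
  have hconst : ∀ i < m, X i = X 0 := by
    intro i
    induction i with
    | zero => intro _; rfl
    | succ i ih => exact fun hi => (hcons i hi).symm.trans (ih (by omega))
  have hpow : ∀ i ≤ m, a i = exp (X 0) ^ i := by
    intro i
    induction i with
    | zero => intro _; simpa using ha0
    | succ i ih =>
      intro hi
      rw [hstep i hi, ih (by omega), hconst i hi, pow_succ]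
  refine ⟨(m : ℝ) • X 0, smul_mem_expDirs (hXe 0) _, ?_⟩
  rw [exp_natCast_smul, ← hpow m le_rfl, ham]

/-- The exponential map of a compact connected group is surjective, provided the ambient algebra has
an inner product that is invariant under conjugation by the group. -/
theorem exists_exp_eq_of_invariant_inner [FiniteDimensional ℝ 𝔸] (b : 𝔸 → 𝔸 → ℝ)
    (hadd : ∀ X X' Y, b (X + X') Y = b X Y + b X' Y) (hsmul : ∀ (c : ℝ) X Y, b (c • X) Y = c * b X Y)
    (hsymm : ∀ X Y, b X Y = b Y X) (hpos : ∀ X, X ≠ 0 → 0 < b X X)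
    (hAd : ∀ a ∈ C, ∀ a' ∈ C, a * a' = 1 → ∀ Y Z, b (a * Y * a') (a * Z * a') = b Y Z)
    (hC : IsCompact (C : Set 𝔸)) (hconn : IsPreconnected (C : Set 𝔸))
    (hinv : ∀ a ∈ C, ∃ b ∈ C, b * a = 1) {g : 𝔸} (hg : g ∈ C) :
    ∃ X : 𝔸, (∀ t : ℝ, exp (t • X) ∈ C) ∧ exp X = g := by
  let b' : 𝔸 →ₗ[ℝ] 𝔸 →ₗ[ℝ] ℝ := LinearMap.mk₂ ℝ b hadd hsmul
    (fun X Y Y' => by rw [hsymm, hadd, hsymm Y, hsymm Y'])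
    (fun c X Y => by rw [hsymm, hsmul, hsymm Y, smul_eq_mul])
  let B : 𝔸 →L[ℝ] 𝔸 →L[ℝ] ℝ :=
    LinearMap.toContinuousLinearMap (LinearMap.toContinuousLinearMap.toLinearMap ∘ₗ b')
  have hB : IsAdInner C B :=
    ⟨hsymm, hpos, fun X hX Y Z => hAd _ (exp_mem_of_expDirs hX) _
      (exp_neg_mem hinv (exp_mem_of_expDirs hX)) (exp_mul_exp_neg X) Y Z⟩
  exact hB.exp_surjective hC hconn hinv hg

end LieExp

end UnitonLoops

namespace UnitonLoops

open NormedSpace Filter Topology MeasureTheory Matrix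
open scoped ComplexOrder

/-! ### Compact matrix groups are unitarizable -/

open scoped MatrixOrder Matrix.Norms.L2Operator in
lemma exists_eq_conjTranspose_mul_self {n : ℕ} {P : Matrix (Fin n) (Fin n) ℂ} (hP : P.PosDef) :
    ∃ R : Matrix (Fin n) (Fin n) ℂ, IsUnit R ∧ P = Rᴴ * R := by
  obtain ⟨R, hR⟩ := CStarAlgebra.nonneg_iff_eq_star_mul_self.mp hP.posSemidef.nonneg
  refine ⟨R, ?_, hR⟩
  rw [isUnit_iff_isUnit_det, isUnit_iff_ne_zero]
  intro h0
  have := hP.det_pos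
  rw [hR, det_mul, h0, mul_zero] at this
  exact lt_irrefl _ this

section Unitary

open scoped Matrix.Norms.Operator

variable {n : ℕ}

/-- Weyl's unitarian trick: averaging `gᴴ g` over a compact matrix group gives an invariant positive
definite Hermitian form. -/
lemma exists_invariant_posDef (H : Subgroup (GL (Fin n) ℂ)) (hH : IsCompact (H : Set (GL (Fin n) ℂ))) :
    ∃ P : Matrix (Fin n) (Fin n) ℂ, P.PosDef ∧
      ∀ g ∈ H, (g : Matrix (Fin n) (Fin n) ℂ)ᴴ * P * (g : Matrix (Fin n) (Fin n) ℂ) = P := by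
  have : CompactSpace H := isCompact_iff_compactSpace.1 hH
  let _ : MeasurableSpace H := borel H
  have : BorelSpace H := ⟨rfl⟩
  let μ : Measure H := Measure.haar
  set m : H → Matrix (Fin n) (Fin n) ℂ := fun g => ((g⁻¹ : H) : GL (Fin n) ℂ) with hm
  have hmc : Continuous m := Units.continuous_val.comp (continuous_subtype_val.comp continuous_inv)
  set f : H → Matrix (Fin n) (Fin n) ℂ := fun g => (m g)ᴴ * m g with hf
  have hfc : Continuous f := by fun_prop
  have hint : ∀ {E : Type} [NormedAddCommGroup E] (F : H → E), Continuous F → Integrable F μ :=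
    fun F hF => hF.integrable_of_hasCompactSupport (HasCompactSupport.of_compactSpace F)
  set P := ∫ g, f g ∂μ with hP
  have hcomm : ∀ T : Matrix (Fin n) (Fin n) ℂ →ₗ[ℝ] Matrix (Fin n) (Fin n) ℂ,
      ∫ g, T (f g) ∂μ = T P := fun T =>
    (LinearMap.toContinuousLinearMap T).integral_comp_comm (hint f hfc)
  -- The three goals (`P` is Hermitian, positive definite and invariant) follow by moving a linear
  -- map inside the integral; for invariance, Haar measure absorbs the left translation.
  refine ⟨P, PosDef.of_dotProduct_mulVec_pos ?_ fun x hx => ?_, fun a ha => ?_⟩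
  · have h1 := hcomm (Matrix.conjTransposeLinearEquiv (Fin n) (Fin n) ℝ ℂ).toLinearMap
    have h2 : ∀ g, (f g)ᴴ = f g := fun g => by simp [hf]
    change ∫ g, (f g)ᴴ ∂μ = Pᴴ at h1
    simp only [h2] at h1
    exact h1.symm
  · let T : Matrix (Fin n) (Fin n) ℂ →ₗ[ℝ] ℂ :=
      { toFun := fun A => star x ⬝ᵥ (A *ᵥ x)
        map_add' := fun A B => by rw [add_mulVec, dotProduct_add]
        map_smul' := fun c A => by rw [smul_mulVec, dotProduct_smul]; rfl }
    have h1 : ∫ g, T (f g) ∂μ = T P :=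
      (LinearMap.toContinuousLinearMap T).integral_comp_comm (hint f hfc)
    have h2 : ∀ g, 0 < T (f g) := fun g => by
      have hinj : Function.Injective (m g).mulVec := by
        have : IsUnit (m g) := ((g⁻¹ : H) : GL (Fin n) ℂ).isUnit
        exact mulVec_injective_of_isUnit this
      exact (PosDef.conjTranspose_mul_self _ hinj).dotProduct_mulVec_pos hx
    have h3 : ∀ g, T (f g) = ((T (f g)).re : ℂ) := fun g =>
      Complex.ext rfl (by simpa using (Complex.lt_def.1 (h2 g)).2.symm)
    have hTc : Continuous fun g => (T (f g)).re :=
      Complex.continuous_re.comp ((LinearMap.continuous_of_finiteDimensional T).comp hfc)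
    have h4 : 0 < ∫ g, (T (f g)).re ∂μ :=
      integral_pos_of_integrable_nonneg_nonzero hTc (hint _ hTc)
        (fun g => (Complex.lt_def.1 (h2 g)).1.le) (x := 1) (Complex.lt_def.1 (h2 1)).1.ne'
    have h5 : T P = ((∫ g, (T (f g)).re ∂μ : ℝ) : ℂ) := by
      rw [← h1, ← integral_complex_ofReal]
      exact integral_congr_ae (Eventually.of_forall h3)
    change 0 < T P
    rw [h5]
    exact_mod_cast h4
  · let T : Matrix (Fin n) (Fin n) ℂ →ₗ[ℝ] Matrix (Fin n) (Fin n) ℂ :=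
      { toFun := fun A => (a : Matrix (Fin n) (Fin n) ℂ)ᴴ * A * (a : Matrix (Fin n) (Fin n) ℂ)
        map_add' := fun A B => by rw [mul_add, add_mul]
        map_smul' := fun c A => by simp }
    have h1 := hcomm T
    have h2 : ∀ g, T (f g) = f ((⟨a, ha⟩ : H)⁻¹ * g) := fun g => by
      have h3 : m ((⟨a, ha⟩ : H)⁻¹ * g) = m g * (a : Matrix (Fin n) (Fin n) ℂ) := by
        simp only [hm, _root_.mul_inv_rev, inv_inv]
        rfl
      simp only [hf, h3, conjTranspose_mul, T, LinearMap.coe_mk, AddHom.coe_mk, Matrix.mul_assoc]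
    simp only [h2] at h1
    rw [integral_mul_left_eq_self] at h1
    exact h1.symm

/-- A compact matrix group is conjugate to a group of unitary matrices. -/
lemma exists_unitarizing (H : Subgroup (GL (Fin n) ℂ)) (hH : IsCompact (H : Set (GL (Fin n) ℂ))) :
    ∃ Q : GL (Fin n) ℂ, ∀ g ∈ H, ((Q * g * Q⁻¹ : GL (Fin n) ℂ) : Matrix (Fin n) (Fin n) ℂ)ᴴ *
      ((Q * g * Q⁻¹ : GL (Fin n) ℂ) : Matrix (Fin n) (Fin n) ℂ) = 1 := by
  obtain ⟨P, hP, hinv⟩ := exists_invariant_posDef H hH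
  obtain ⟨R, hR, hRP⟩ := exists_eq_conjTranspose_mul_self hP
  obtain ⟨Q, rfl⟩ := hR
  refine ⟨Q, fun g hg => ?_⟩
  have h1 := hinv g hg
  have h2 : (Q : Matrix (Fin n) (Fin n) ℂ) * ((Q⁻¹ : GL (Fin n) ℂ) : Matrix (Fin n) (Fin n) ℂ) = 1 :=
    Units.mul_inv Q
  have h3 : ((Q⁻¹ : GL (Fin n) ℂ) : Matrix (Fin n) (Fin n) ℂ)ᴴ *
      (Q : Matrix (Fin n) (Fin n) ℂ)ᴴ = 1 := by
    rw [← conjTranspose_mul, h2, conjTranspose_one]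
  simp only [Units.val_mul, conjTranspose_mul]
  calc _ = ((Q⁻¹ : GL (Fin n) ℂ) : Matrix (Fin n) (Fin n) ℂ)ᴴ *
        ((g : Matrix (Fin n) (Fin n) ℂ)ᴴ * ((Q : Matrix (Fin n) (Fin n) ℂ)ᴴ *
          (Q : Matrix (Fin n) (Fin n) ℂ)) * (g : Matrix (Fin n) (Fin n) ℂ)) *
          ((Q⁻¹ : GL (Fin n) ℂ) : Matrix (Fin n) (Fin n) ℂ) := by simp only [mul_assoc]
    _ = 1 := by
      rw [← hRP, h1, hRP, ← mul_assoc, h3, one_mul, h2]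

/-- In a compact connected matrix group every element lies on a one-parameter group. -/
theorem exists_exp_eq_of_isCompact (H : Subgroup (GL (Fin n) ℂ))
    (hH : IsCompact (H : Set (GL (Fin n) ℂ))) (hconn : IsPreconnected (H : Set (GL (Fin n) ℂ)))
    {g : GL (Fin n) ℂ} (hg : g ∈ H) :
    ∃ X : Matrix (Fin n) (Fin n) ℂ,
      (∀ t : ℝ, ∃ a ∈ H, (a : Matrix (Fin n) (Fin n) ℂ) = exp (t • X)) ∧ exp X = g.val := by
  obtain ⟨Q, hQ⟩ := exists_unitarizing H hH
  let C : Submonoid (Matrix (Fin n) (Fin n) ℂ) := H.toSubmonoid.map (Units.coeHom _)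
  have hCset : (C : Set (Matrix (Fin n) (Fin n) ℂ)) = Units.val '' (H : Set (GL (Fin n) ℂ)) := rfl
  have hinv : ∀ a ∈ C, ∃ b ∈ C, b * a = 1 := by
    rintro _ ⟨a, ha, rfl⟩
    exact ⟨_, ⟨a⁻¹, H.inv_mem ha, rfl⟩, Units.inv_mul a⟩
  -- The inner product is the Frobenius inner product of the conjugates by `Q`.
  let b : Matrix (Fin n) (Fin n) ℂ → Matrix (Fin n) (Fin n) ℂ → ℝ := fun X Y =>
    (trace ((Q.val * X * Q⁻¹.val)ᴴ * (Q.val * Y * Q⁻¹.val))).re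
  have hsymm : ∀ X Y, b X Y = b Y X := fun X Y => by
    simp only [b]
    rw [← Complex.conj_re, ← Complex.star_def, ← trace_conjTranspose, conjTranspose_mul,
      conjTranspose_conjTranspose]
  have hpos : ∀ X, X ≠ 0 → 0 < b X X := fun X hX => by
    simp only [b]
    set Y := Q.val * X * Q⁻¹.val with hY
    have hY0 : Y ≠ 0 := by
      intro h0
      apply hX
      have : X = Q⁻¹.val * Y * Q.val := by
        rw [hY]
        simp only [← mul_assoc]
        rw [Units.inv_mul, one_mul, mul_assoc, Units.inv_mul, mul_one]
      rw [this, h0, mul_zero, zero_mul]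
    have h1 : 0 ≤ trace (Yᴴ * Y) := (posSemidef_conjTranspose_mul_self Y).trace_nonneg
    have h2 : trace (Yᴴ * Y) ≠ 0 := fun h => hY0 (trace_conjTranspose_mul_self_eq_zero_iff.1 h)
    exact (Complex.lt_def.1 (lt_of_le_of_ne h1 h2.symm)).1
  have hAd : ∀ a ∈ C, ∀ a' ∈ C, a * a' = 1 → ∀ Y Z, b (a * Y * a') (a * Z * a') = b Y Z := by
    rintro _ ⟨a, ha, rfl⟩ a' - haa Y Z
    have hae2 : a' = a⁻¹.val := (left_inv_eq_right_inv (Units.inv_mul a) haa).symm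
    subst hae2
    have hu := hQ a ha
    set u : GL (Fin n) ℂ := Q * a * Q⁻¹ with hu'
    have hconj : ∀ Y : Matrix (Fin n) (Fin n) ℂ, Q.val * (a.val * Y * a⁻¹.val) * Q⁻¹.val =
        u.val * (Q.val * Y * Q⁻¹.val) * u⁻¹.val := fun Y => by
      rw [hu']
      simp only [_root_.mul_inv_rev, inv_inv, Units.val_mul, mul_assoc]
      simp only [Units.inv_mul_cancel_left]
    change (trace ((Q.val * (a.val * Y * a⁻¹.val) * Q⁻¹.val)ᴴ *
      (Q.val * (a.val * Z * a⁻¹.val) * Q⁻¹.val))).re =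
      (trace ((Q.val * Y * Q⁻¹.val)ᴴ * (Q.val * Z * Q⁻¹.val))).re
    rw [hconj, hconj]
    set Y' := Q.val * Y * Q⁻¹.val
    set Z' := Q.val * Z * Q⁻¹.val
    have h1 : (u.val * Y' * u⁻¹.val)ᴴ * (u.val * Z' * u⁻¹.val) =
        (u⁻¹.val)ᴴ * (Y'ᴴ * Z' * u⁻¹.val) := by
      simp only [conjTranspose_mul, mul_assoc]
      rw [← mul_assoc u.valᴴ, hu, one_mul]
    have h2 : u⁻¹.val * (u⁻¹.val)ᴴ = 1 := by
      have h3 : u.valᴴ = u⁻¹.val := left_inv_eq_right_inv hu (Units.mul_inv u)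
      rw [← h3, conjTranspose_conjTranspose, hu]
    rw [h1, trace_mul_comm, mul_assoc, h2, mul_one]
  obtain ⟨X, hX, hXg⟩ := exists_exp_eq_of_invariant_inner (C := C) b
    (fun X X' Y => by simp [b, mul_add, add_mul]) (fun c X Y => by simp [b]) hsymm hpos hAd
    (hCset ▸ hH.image Units.continuous_val)
    (hCset ▸ hconn.image _ Units.continuous_val.continuousOn) hinv ⟨g, hg, rfl⟩
  exact ⟨X, fun t => hX t, hXg⟩

end Unitary

end UnitonLoops

namespace UnitonLoops

open scoped ComplexOrder
open NormedSpace Filter Topology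

/-! ### Trigonometric polynomials and weighted Wiener algebras -/

noncomputable section LoopAlgebras

/-- The monomial `λ ↦ λᵏ` on the circle. -/
def circleMonomial (k : ℤ) : Circle → ℂ := fun l => (l : ℂ) ^ k

lemma circleMonomial_add (k m : ℤ) :
    circleMonomial (k + m) = circleMonomial k * circleMonomial m :=
  funext fun l => zpow_add₀ l.coe_ne_zero k m

lemma star_circleMonomial (k : ℤ) : star (circleMonomial k) = circleMonomial (-k) := by
  ext l
  simp only [circleMonomial, Pi.star_apply, Complex.star_def, map_zpow₀, zpow_neg]
  rw [← Circle.coe_inv_eq_conj, Circle.coe_inv, inv_zpow]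

/-- The algebra of trigonometric polynomials on the circle. -/
def trigAlgebra : Subalgebra ℂ (Circle → ℂ) :=
  (AddMonoidAlgebra.lift ℂ (Circle → ℂ) ℤ
    { toFun := fun k => circleMonomial k.toAdd
      map_one' := by ext l; simp [circleMonomial]
      map_mul' := fun k m => circleMonomial_add _ _ }).range

lemma mem_trigAlgebra_iff {f : Circle → ℂ} :
    f ∈ trigAlgebra ↔ ∃ p : ℤ →₀ ℂ, f = p.sum fun k c => c • circleMonomial k := by
  constructor
  · rintro ⟨p, rfl⟩
    refine ⟨p.coeff, ?_⟩
    exact AddMonoidAlgebra.lift_apply ..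
  · rintro ⟨p, rfl⟩
    exact ⟨.ofCoeff p, AddMonoidAlgebra.lift_apply ..⟩

lemma circleMonomial_mem_trigAlgebra (k : ℤ) : circleMonomial k ∈ trigAlgebra :=
  mem_trigAlgebra_iff.2 ⟨Finsupp.single k 1, by simp⟩

lemma star_mem_trigAlgebra {f : Circle → ℂ} (hf : f ∈ trigAlgebra) : star f ∈ trigAlgebra := by
  obtain ⟨p, rfl⟩ := mem_trigAlgebra_iff.1 hf
  rw [Finsupp.sum, star_sum]
  refine sum_mem fun k _ => ?_
  rw [star_smul, star_circleMonomial]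
  exact trigAlgebra.smul_mem (circleMonomial_mem_trigAlgebra _) _

variable {w : ℤ → ℝ}

lemma IsLoopWeight.pos (hw : IsLoopWeight w) (k : ℤ) : 0 < w k := one_pos.trans_le (hw.one_le k)

lemma IsLoopWeight.summable_norm (hw : IsLoopWeight w) {c : ℤ → ℂ}
    (hc : Summable fun k => w k * ‖c k‖) : Summable fun k => ‖c k‖ :=
  hc.of_nonneg_of_le (fun _ => norm_nonneg _) fun k =>
    le_mul_of_one_le_left (norm_nonneg _) (hw.one_le k)

/-- The carrier of the weighted Wiener algebra: the functions `f(λ) = ∑ λᵏ cₖ` on the circle with `∑ w(k) |cₖ| < ∞`. -/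
def wienerSet (w : ℤ → ℝ) : Set (Circle → ℂ) :=
  {f | ∃ c : ℤ → ℂ, Summable (fun k => w k * ‖c k‖) ∧
    ∀ l : Circle, HasSum (fun k : ℤ => (l : ℂ) ^ k * c k) (f l)}

/-- The Cauchy product of two weighted absolutely convergent Fourier series. -/
lemma IsLoopWeight.mul_mem_wienerSet (hw : IsLoopWeight w) {f g : Circle → ℂ}
    (hf : f ∈ wienerSet w) (hg : g ∈ wienerSet w) : f * g ∈ wienerSet w := by
  obtain ⟨a, ha, hfa⟩ := hf
  obtain ⟨b, hb, hgb⟩ := hg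
  -- `e (m, k) = (k, m - k)` collects the pairs of exponents with sum `m`.
  let e : ℤ × ℤ ≃ ℤ × ℤ :=
    { toFun := fun q => (q.2, q.1 - q.2)
      invFun := fun q => (q.1 + q.2, q.1)
      left_inv := fun q => by simp
      right_inv := fun q => by simp }
  have hG : Summable fun q : ℤ × ℤ => (w q.1 * ‖a q.1‖) * (w q.2 * ‖b q.2‖) :=
    ha.mul_of_nonneg hb (fun k => mul_nonneg (hw.pos k).le (norm_nonneg _))
      (fun k => mul_nonneg (hw.pos k).le (norm_nonneg _))
  have hGe := (Equiv.summable_iff e).2 hG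
  have hN : Summable fun q : ℤ × ℤ => ‖a q.1‖ * ‖b q.2‖ :=
    (hw.summable_norm ha).mul_of_nonneg (hw.summable_norm hb) (fun k => norm_nonneg _)
      (fun k => norm_nonneg _)
  have hNe := (Equiv.summable_iff e).2 hN
  have hNm : ∀ m : ℤ, Summable fun k : ℤ => ‖a k * b (m - k)‖ := fun m => by
    have := hNe.prod_factor m
    simpa [e, norm_mul] using this
  refine ⟨fun m => ∑' k : ℤ, a k * b (m - k), ?_, fun l => ?_⟩
  · refine hGe.prod.of_nonneg_of_le (fun m => mul_nonneg (hw.pos m).le (norm_nonneg _)) fun m => ?_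
    have h1 : ‖∑' k : ℤ, a k * b (m - k)‖ ≤ ∑' k : ℤ, ‖a k * b (m - k)‖ :=
      norm_tsum_le_tsum_norm (hNm m)
    calc w m * ‖∑' k : ℤ, a k * b (m - k)‖ ≤ w m * ∑' k : ℤ, ‖a k * b (m - k)‖ :=
          mul_le_mul_of_nonneg_left h1 (hw.pos m).le
      _ = ∑' k : ℤ, w m * ‖a k * b (m - k)‖ := tsum_mul_left.symm
      _ ≤ _ := by
        refine Summable.tsum_le_tsum (fun k => ?_) ((hNm m).mul_left _) (hGe.prod_factor m)
        have h2 : w m ≤ w k * w (m - k) := by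
          have := hw.submul k (m - k)
          rwa [add_sub_cancel] at this
        calc w m * ‖a k * b (m - k)‖ ≤ (w k * w (m - k)) * ‖a k * b (m - k)‖ :=
              mul_le_mul_of_nonneg_right h2 (norm_nonneg _)
          _ = _ := by
            simp only [e, Function.comp_apply, Equiv.coe_fn_mk, norm_mul]
            ring
  · have hl : ∀ k : ℤ, ‖(l : ℂ) ^ k‖ = 1 := fun k => by rw [norm_zpow, Circle.norm_coe, one_zpow]
    have hsum : Summable fun q : ℤ × ℤ => ((l : ℂ) ^ q.1 * a q.1) * ((l : ℂ) ^ q.2 * b q.2) := by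
      refine Summable.of_norm ?_
      simpa only [norm_mul, hl, one_mul] using hN
    have h1 := (Equiv.hasSum_iff e).2 ((hfa l).mul (hgb l) hsum)
    refine h1.prod_fiberwise fun m => ?_
    have h2 := ((hNm m).of_norm.hasSum).mul_left ((l : ℂ) ^ m)
    refine h2.congr_fun fun k => ?_
    have h3 : (l : ℂ) ^ m = (l : ℂ) ^ k * (l : ℂ) ^ (m - k) := by
      rw [← zpow_add₀ l.coe_ne_zero, add_sub_cancel]
    simp only [e, Function.comp_apply, Equiv.coe_fn_mk]
    rw [h3]
    ring

/-- The weighted Wiener algebra of the circle. -/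
def wienerAlgebra (hw : IsLoopWeight w) : Subalgebra ℂ (Circle → ℂ) where
  carrier := wienerSet w
  mul_mem' := hw.mul_mem_wienerSet
  add_mem' := by
    rintro f g ⟨a, ha, hfa⟩ ⟨b, hb, hgb⟩
    refine ⟨a + b, ?_, fun l => ?_⟩
    · refine (ha.add hb).of_nonneg_of_le (fun k => mul_nonneg (hw.pos k).le (norm_nonneg _))
        fun k => ?_
      rw [← mul_add]
      exact mul_le_mul_of_nonneg_left (norm_add_le _ _) (hw.pos k).le
    · simpa only [Pi.add_apply, mul_add] using (hfa l).add (hgb l)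
  algebraMap_mem' := by
    intro z
    refine ⟨fun k => if k = 0 then z else 0, ?_, fun l => ?_⟩
    · refine summable_of_ne_finset_zero (s := {0}) fun k hk => ?_
      simp [Finset.notMem_singleton.1 hk]
    · convert hasSum_ite_eq (0 : ℤ) z using 2 with k
      · split_ifs with h <;> simp [h]
      · rfl

lemma circleMonomial_mem_wienerAlgebra (hw : IsLoopWeight w) (m : ℤ) :
    circleMonomial m ∈ wienerAlgebra hw := by
  refine ⟨fun k => if k = m then 1 else 0, ?_, fun l => ?_⟩
  · refine summable_of_ne_finset_zero (s := {m}) fun k hk => ?_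
    simp [Finset.notMem_singleton.1 hk]
  · convert hasSum_ite_eq m ((l : ℂ) ^ m) using 2 with k
    · split_ifs with h <;> simp [h]
    · rfl

lemma trigAlgebra_le_wienerAlgebra (hw : IsLoopWeight w) : trigAlgebra ≤ wienerAlgebra hw := by
  intro f hf
  obtain ⟨p, rfl⟩ := mem_trigAlgebra_iff.1 hf
  exact sum_mem fun k _ => (wienerAlgebra hw).smul_mem (circleMonomial_mem_wienerAlgebra hw _) _

lemma star_mem_wienerAlgebra (hw : IsLoopWeight w) {f : Circle → ℂ} (hf : f ∈ wienerAlgebra hw) :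
    star f ∈ wienerAlgebra hw := by
  obtain ⟨c, hc, hfc⟩ := hf
  refine ⟨fun k => star (c (-k)), ?_, fun l => ?_⟩
  · refine ((Equiv.neg ℤ).summable_iff.2 hc).congr fun k => ?_
    simp [hw.symm k]
  · refine (((Equiv.neg ℤ).hasSum_iff.2 (hfc l)).star).congr_fun fun k => ?_
    have h1 : star ((l : ℂ) ^ (-k)) = (l : ℂ) ^ k := by
      have := congrFun (star_circleMonomial (-k)) l
      rwa [neg_neg] at this
    simp only [Function.comp_apply, Equiv.neg_apply]
    rw [star_mul', h1]

variable {n : ℕ} {G : Subgroup (GL (Fin n) ℂ)}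

/-- The entries of a loop belong to the algebra `𝒜`. -/
def HasEntriesIn (𝒜 : Subalgebra ℂ (Circle → ℂ)) (γ : Circle → G) : Prop :=
  ∀ i j, (fun l => mat (γ l) i j) ∈ 𝒜

lemma HasEntriesIn.mul {𝒜 : Subalgebra ℂ (Circle → ℂ)} {γ δ : Circle → G}
    (hγ : HasEntriesIn 𝒜 γ) (hδ : HasEntriesIn 𝒜 δ) : HasEntriesIn 𝒜 (γ * δ) := by
  intro i j
  have : (fun l => mat ((γ * δ) l) i j) =
      ∑ k, (fun l => mat (γ l) i k) * (fun l => mat (δ l) k j) := by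
    ext l
    simp [mat, Matrix.mul_apply]
  rw [this]
  exact sum_mem fun k _ => 𝒜.mul_mem (hγ i k) (hδ k j)

/-- In a compact matrix group the inverse is `P' gᴴ P` for fixed matrices `P`, `P'`. -/
lemma exists_inv_eq (hG : IsCompact (G : Set (GL (Fin n) ℂ))) :
    ∃ P P' : Matrix (Fin n) (Fin n) ℂ, ∀ g : G, mat g⁻¹ = P' * (mat g).conjTranspose * P := by
  obtain ⟨P, hP, hinv⟩ := exists_invariant_posDef G hG
  refine ⟨P, P⁻¹, fun g => ?_⟩
  have h1 : P⁻¹ * (mat g).conjTranspose * P * mat g = 1 := by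
    have h2 := hinv g g.2
    rw [mul_assoc, mul_assoc, ← mul_assoc _ P]
    change P⁻¹ * ((mat g).conjTranspose * P * mat g) = 1
    rw [show (mat g).conjTranspose * P * mat g = P from h2]
    exact Matrix.nonsing_inv_mul P ((Matrix.isUnit_iff_isUnit_det P).1 hP.isUnit)
  exact (left_inv_eq_right_inv h1 (Units.mul_inv (g : GL (Fin n) ℂ))).symm

/-- A star-closed function algebra that contains the entries of a loop in a compact group also
contains those of the inverse loop. -/
lemma HasEntriesIn.inv (hG : IsCompact (G : Set (GL (Fin n) ℂ))) {𝒜 : Subalgebra ℂ (Circle → ℂ)}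
    (h𝒜 : ∀ f ∈ 𝒜, star f ∈ 𝒜) {γ : Circle → G} (hγ : HasEntriesIn 𝒜 γ) :
    HasEntriesIn 𝒜 γ⁻¹ := by
  obtain ⟨P, P', hP⟩ := exists_inv_eq hG
  intro i j
  have : (fun l => mat (γ⁻¹ l) i j) =
      ∑ k, ∑ m, (P' i m * P k j) • star (fun l => mat (γ l) k m) := by
    ext l
    rw [Pi.inv_apply, hP]
    simp only [Matrix.mul_apply, Finset.sum_apply, Pi.smul_apply, Pi.star_apply,
      Matrix.conjTranspose_apply, smul_eq_mul, Finset.sum_mul]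
    refine Finset.sum_congr rfl fun k _ => Finset.sum_congr rfl fun m _ => ?_
    ring
  rw [this]
  exact sum_mem fun k _ => sum_mem fun m _ => 𝒜.smul_mem (h𝒜 _ (hγ k m)) _

lemma mem_loopGroup_iff (hw : IsLoopWeight w) {γ : Circle → G} :
    γ ∈ loopGroup G w ↔ HasEntriesIn (wienerAlgebra hw) γ := by
  constructor
  · rintro ⟨c, hc, hγ⟩ i j
    refine ⟨fun k => c k i j, hc i j, fun l => ?_⟩
    exact Pi.hasSum.1 (Pi.hasSum.1 (hγ l) i) j
  · intro hγ
    choose c hc hγc using hγ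
    refine ⟨fun k => Matrix.of fun i j => c i j k, fun i j => hc i j, fun l => ?_⟩
    exact Pi.hasSum.2 fun i => Pi.hasSum.2 fun j => hγc i j l

lemma mem_algLoops_iff {γ : Circle → G} :
    γ ∈ algLoops G ↔ γ 1 = 1 ∧ HasEntriesIn trigAlgebra γ := by
  refine and_congr_right fun _ => ⟨?_, fun hγ => ?_⟩
  · rintro ⟨N, c, hγ⟩ i j
    have : (fun l => mat (γ l) i j) =
        ∑ k ∈ Finset.Icc (-(N : ℤ)) N, c k i j • circleMonomial k := by
      ext l
      rw [hγ l]
      simp [Matrix.sum_apply, circleMonomial, mul_comm]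
    rw [this]
    exact sum_mem fun k _ => trigAlgebra.smul_mem (circleMonomial_mem_trigAlgebra k) _
  · choose p hp using fun i j => mem_trigAlgebra_iff.1 (hγ i j)
    set N : ℕ := Finset.univ.sup fun i => Finset.univ.sup fun j => (p i j).support.sup Int.natAbs
    refine ⟨N, fun k => Matrix.of fun i j => p i j k, fun l => ?_⟩
    ext i j
    have h1 := congrFun (hp i j) l
    change mat (γ l) i j = _ at h1
    rw [h1, Matrix.sum_apply, Finsupp.sum, Finset.sum_apply]
    have hsub : (p i j).support ⊆ Finset.Icc (-(N : ℤ)) N := by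
      intro k hk
      have h2 : k.natAbs ≤ N :=
        (Finset.le_sup (f := Int.natAbs) hk).trans
          ((Finset.le_sup (f := fun j => (p i j).support.sup Int.natAbs) (Finset.mem_univ j)).trans
          (Finset.le_sup (f := fun i => Finset.univ.sup fun j => (p i j).support.sup Int.natAbs)
            (Finset.mem_univ i)))
      rw [Finset.mem_Icc]
      omega
    rw [Finset.sum_subset hsub fun k _ hk => by simp [Finsupp.notMem_support_iff.1 hk]]
    simp [circleMonomial, mul_comm]

end LoopAlgebras

/-! ### Periodic one-parameter groups -/

noncomputable section PeriodicExp

variable {𝔸 : Type*} [NormedRing 𝔸] [NormedAlgebra ℂ 𝔸]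
  [CompleteSpace 𝔸]

/-- The one-parameter group of `ξ` on a generalized eigenvector of rank two. -/
lemma exp_smul_mul_of_rank_two {ξ Y W : 𝔸} {μ : ℂ} (hY : ξ * Y = μ • Y + W) (hW : ξ * W = μ • W)
    (t : ℂ) : exp (t • ξ) * Y = Complex.exp (t * μ) • (Y + t • W) := by
  set φ : ℂ → 𝔸 := fun t => exp (t • (-ξ)) * (Complex.exp (t * μ) • (Y + t • W)) with hφ
  have hd : ∀ t, HasDerivAt φ 0 t := by
    intro t
    have h1 : HasDerivAt (fun t : ℂ => Complex.exp (t * μ)) (Complex.exp (t * μ) * μ) t := by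
      have := ((hasDerivAt_id t).mul_const μ).cexp
      simpa using this
    have h2 : HasDerivAt (fun t : ℂ => Y + t • W) W t := by
      simpa using ((hasDerivAt_id t).smul_const W).const_add Y
    have h3 := (hasDerivAt_exp_smul_const (-ξ) t).mul (h1.smul h2)
    refine h3.congr_deriv ?_
    rw [mul_assoc, ← mul_add]
    convert mul_zero _
    simp only [neg_mul, mul_smul_comm, mul_add, hY, hW, Pi.smul_apply']
    module
  have hc : φ t = φ 0 := is_const_of_deriv_eq_zero (fun t => (hd t).differentiableAt)
    (fun t => (hd t).deriv) t 0
  have h0 : φ 0 = Y := by simp [hφ, exp_zero]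
  rw [h0] at hc
  have h1 : exp (t • ξ) * exp (t • (-ξ)) = 1 := by
    let _ : NormedAlgebra ℝ 𝔸 := NormedAlgebra.restrictScalars ℝ ℂ 𝔸
    rw [smul_neg, exp_mul_exp_neg]
  calc exp (t • ξ) * Y = exp (t • ξ) * φ t := by rw [hc]
    _ = _ := by rw [hφ, ← mul_assoc, h1, one_mul]

/-- If `exp (2π ξ) = 1` then `t ↦ exp (t ξ)` is a trigonometric polynomial: `ξ` is diagonalizable
with eigenvalues in `iℤ`. -/
lemma exists_exp_smul_eq_sum [FiniteDimensional ℂ 𝔸] {ξ : 𝔸} (hξ : exp ((2 * Real.pi : ℂ) • ξ) = 1) :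
    ∃ p : ℤ →₀ 𝔸, ∀ t : ℂ, exp (t • ξ) = p.sum fun k c => Complex.exp (t * Complex.I) ^ k • c := by
  -- `S` consists of the `X` for which `exp (t ξ) X` is a trigonometric polynomial. It contains every
  -- generalized eigenspace of left multiplication by `ξ`, hence `1`.
  let S : Submodule ℂ 𝔸 :=
    { carrier := {X | ∃ p : ℤ →₀ 𝔸, ∀ t : ℂ,
        exp (t • ξ) * X = p.sum fun k c => Complex.exp (t * Complex.I) ^ k • c}
      add_mem' := by
        rintro X Y ⟨p, hp⟩ ⟨q, hq⟩
        refine ⟨p + q, fun t => ?_⟩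
        rw [mul_add, hp, hq, Finsupp.sum_add_index' (fun _ => smul_zero _) fun _ _ _ => smul_add _ _ _]
      zero_mem' := ⟨0, by simp⟩
      smul_mem' := by
        rintro c X ⟨p, hp⟩
        refine ⟨c • p, fun t => ?_⟩
        rw [mul_smul_comm, hp, Finsupp.sum_smul_index' (fun _ => smul_zero _), Finsupp.smul_sum]
        exact Finsupp.sum_congr fun k _ => smul_comm _ _ _ }
  suffices h : (⊤ : Submodule ℂ 𝔸) ≤ S by
    obtain ⟨p, hp⟩ : (1 : 𝔸) ∈ S := h trivial
    exact ⟨p, fun t => by simpa using hp t⟩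
  set T : Module.End ℂ 𝔸 := LinearMap.mulLeft ℂ ξ with hT
  rw [← Module.End.iSup_maxGenEigenspace_eq_top T]
  refine iSup_le fun μ X hX => ?_
  have h2pi : ∀ Y W : 𝔸, ξ * Y = μ • Y + W → ξ * W = μ • W →
      Y = Complex.exp ((2 * Real.pi : ℂ) * μ) • (Y + (2 * Real.pi : ℂ) • W) := fun Y W hY hW => by
    rw [← exp_smul_mul_of_rank_two hY hW, hξ, one_mul]
  -- A generalized eigenvector of rank two would grow linearly along the one-parameter group, so all
  -- generalized eigenvectors are eigenvectors.
  have hrank : ∀ Y : 𝔸, (T - algebraMap ℂ _ μ) ((T - algebraMap ℂ _ μ) Y) = 0 →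
      (T - algebraMap ℂ _ μ) Y = 0 := by
    intro Y hY
    set W := (T - algebraMap ℂ _ μ) Y with hW
    have h1 : ξ * Y = μ • Y + W := by simp [hW, hT, Module.algebraMap_end_apply]
    have h2 : ξ * W = μ • W := by
      rw [LinearMap.sub_apply, Module.algebraMap_end_apply, sub_eq_zero] at hY
      exact hY
    by_contra hne
    have h3 := h2pi Y W h1 h2
    have h4 : Complex.exp ((2 * Real.pi : ℂ) * μ) = 1 := by
      have h5 := h2pi W 0 (by rw [h2, add_zero]) (by simp)
      rw [smul_zero, add_zero] at h5
      have h6 : (1 - Complex.exp ((2 * Real.pi : ℂ) * μ)) • W = 0 := by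
        rw [sub_smul, one_smul, ← h5, sub_self]
      exact (sub_eq_zero.1 ((smul_eq_zero.1 h6).resolve_right hne)).symm
    rw [h4, one_smul] at h3
    have h7 : (2 * Real.pi : ℂ) • W = 0 := by simpa using h3.symm
    exact hne ((smul_eq_zero.1 h7).resolve_left (by simp [Real.pi_ne_zero]))
  obtain ⟨k, hk⟩ := Module.End.mem_maxGenEigenspace T μ X |>.1 hX
  have heig : ξ * X = μ • X := by
    have key : ∀ k : ℕ, ((T - algebraMap ℂ _ μ) ^ (k + 1)) X = 0 → (T - algebraMap ℂ _ μ) X = 0 := by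
      intro k
      induction k with
      | zero => intro h; simpa using h
      | succ k ih =>
        intro h
        apply ih
        rw [pow_succ', Module.End.mul_apply]
        apply hrank
        rw [pow_succ', pow_succ'] at h
        exact h
    have h1 : (T - algebraMap ℂ _ μ) X = 0 := by
      apply key k
      rw [pow_succ', Module.End.mul_apply]
      have : T - algebraMap ℂ _ μ = T - μ • 1 := by rw [Algebra.algebraMap_eq_smul_one]
      rw [this, hk, map_zero]
    rw [LinearMap.sub_apply, Module.algebraMap_end_apply, sub_eq_zero] at h1
    exact h1
  rcases eq_or_ne X 0 with rfl | hX0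
  · exact S.zero_mem
  have h1 := h2pi X 0 (by rw [heig, add_zero]) (by simp)
  rw [smul_zero, add_zero] at h1
  have h4 : Complex.exp ((2 * Real.pi : ℂ) * μ) = 1 := by
    have h6 : (1 - Complex.exp ((2 * Real.pi : ℂ) * μ)) • X = 0 := by
      rw [sub_smul, one_smul, ← h1, sub_self]
    exact (sub_eq_zero.1 ((smul_eq_zero.1 h6).resolve_right hX0)).symm
  obtain ⟨m, hm⟩ := Complex.exp_eq_one_iff.1 h4
  have hμ : μ = m * Complex.I := by
    have hpi : (2 * Real.pi : ℂ) ≠ 0 := by simp [Real.pi_ne_zero]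
    refine mul_left_cancel₀ hpi ?_
    rw [hm]
    ring
  refine ⟨Finsupp.single m X, fun t => ?_⟩
  rw [exp_smul_mul_of_rank_two (W := 0) (by rw [heig, add_zero]) (by simp), smul_zero, add_zero,
    Finsupp.sum_single_index (h := fun (k : ℤ) (c : 𝔸) => Complex.exp (t * Complex.I) ^ k • c)
      (smul_zero _), ← Complex.exp_int_mul, hμ]
  congr 2
  ring

end PeriodicExp

/-! ### Maximal tori and loops in tori -/

noncomputable section Tori

variable {n : ℕ} {G : Subgroup (GL (Fin n) ℂ)}

lemma mat_injective : Function.Injective (mat : G → Matrix (Fin n) (Fin n) ℂ) :=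
  fun _ _ h => Subtype.ext (Units.ext h)

@[simp] lemma mat_one : mat (1 : G) = 1 := rfl

@[simp] lemma mat_mul (a b : G) : mat (a * b) = mat a * mat b := rfl

lemma mat_mul_mat_inv (a : G) : mat a * mat a⁻¹ = 1 := by
  rw [← mat_mul, mul_inv_cancel, mat_one]

lemma mat_inv_mul_mat (a : G) : mat a⁻¹ * mat a = 1 := by
  rw [← mat_mul, inv_mul_cancel, mat_one]

lemma matrix_exp_add_smul (s t : ℝ) (X : Matrix (Fin n) (Fin n) ℂ) :
    exp ((s + t) • X) = exp (s • X) * exp (t • X) := by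
  rw [add_smul]
  exact Matrix.exp_add_of_commute _ _ (((Commute.refl X).smul_left s).smul_right t)

lemma matrix_exp_zero : exp (0 : Matrix (Fin n) (Fin n) ℂ) = 1 := exp_zero

/-- The homomorphism `t ↦ exp (t X)` into `G`. -/
lemma exists_oneParam {H : Subgroup G} {X : Matrix (Fin n) (Fin n) ℂ} (hX : X ∈ lieAlg H) :
    ∃ ρ : Multiplicative ℝ →* G, Continuous ρ ∧
      ∀ t : ℝ, ρ (.ofAdd t) ∈ H ∧ mat (ρ (.ofAdd t)) = exp (t • X) := by
  choose ρ hρH hρ using hX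
  have h0 : ρ 0 = 1 := mat_injective (by rw [hρ, zero_smul, matrix_exp_zero, mat_one])
  have hadd : ∀ s t, ρ (s + t) = ρ s * ρ t := fun s t =>
    mat_injective (by rw [hρ, mat_mul, hρ, hρ, matrix_exp_add_smul])
  have hc : Continuous fun t : ℝ => exp (t • X) := by
    have : Continuous (exp : Matrix (Fin n) (Fin n) ℂ → Matrix (Fin n) (Fin n) ℂ) :=
      open scoped Matrix.Norms.Operator in continuous_exp
    exact this.comp (by fun_prop)
  refine ⟨⟨⟨fun t => ρ t.toAdd, h0⟩, fun s t => hadd _ _⟩, ?_, fun t => ⟨hρH t, hρ t⟩⟩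
  refine Continuous.subtype_mk (p := fun x => x ∈ G) (f := fun t : Multiplicative ℝ =>
    (ρ t.toAdd : GL (Fin n) ℂ)) ?_ _
  rw [Units.continuous_iff]
  constructor
  · exact hc.congr fun t => (hρ t).symm
  · have h1 : ∀ t, ρ (-t) = (ρ t)⁻¹ := fun t =>
      eq_inv_of_mul_eq_one_left (by rw [← hadd, neg_add_cancel, h0])
    refine (hc.comp continuous_neg).congr fun t => ?_
    change exp ((-t : ℝ) • X) = mat (ρ t)⁻¹
    rw [← h1, hρ]

/-- The closure of a one-parameter subgroup of a compact group is a torus. -/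
lemma exists_isTorus_of_oneParam (hG : IsCompact (G : Set (GL (Fin n) ℂ)))
    {ρ : Multiplicative ℝ →* G} (hρ : Continuous ρ) (t : ℝ) :
    ∃ T : Subgroup G, IsTorus T ∧ ρ (.ofAdd t) ∈ T := by
  have : CompactSpace G := isCompact_iff_compactSpace.1 hG
  refine ⟨ρ.range.topologicalClosure, ⟨?_, ?_, ?_⟩, ?_⟩
  · exact ρ.range.isClosed_topologicalClosure.isCompact
  · have h1 : IsConnected (Set.range ρ) :=
      isConnected_range (f := fun t : ℝ => ρ (.ofAdd t)) (hρ.comp continuous_ofAdd)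
    exact h1.closure
  · have hcomm : ∀ a b : ρ.range, a * b = b * a := by
      rintro ⟨_, s, rfl⟩ ⟨_, t, rfl⟩
      exact Subtype.ext (by simp only [Subgroup.coe_mul, ← map_mul, mul_comm])
    intro a ha b hb
    exact congrArg Subtype.val
      ((ρ.range.commGroupTopologicalClosure hcomm).mul_comm ⟨a, ha⟩ ⟨b, hb⟩)
  · exact ρ.range.le_topologicalClosure ⟨_, rfl⟩

/-- Every torus of a compact group is contained in a maximal torus. -/
lemma IsTorus.exists_le_isMaximalTorus (hG : IsCompact (G : Set (GL (Fin n) ℂ))) {T₀ : Subgroup G}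
    (hT₀ : IsTorus T₀) : ∃ T : Subgroup G, IsMaximalTorus T ∧ T₀ ≤ T := by
  have : CompactSpace G := isCompact_iff_compactSpace.1 hG
  obtain ⟨T, hle, hT⟩ := zorn_le_nonempty₀ {T : Subgroup G | IsTorus T} (fun c hc hchain y hy => by
    -- The closure of the union of a chain of tori is again a torus.
    have hdir : DirectedOn (· ≤ ·) c := hchain.directedOn
    have hmem : ∀ {x}, x ∈ sSup c ↔ ∃ s ∈ c, x ∈ s := Subgroup.mem_sSup_of_directedOn ⟨y, hy⟩ hdir
    refine ⟨(sSup c).topologicalClosure, ⟨?_, ?_, ?_⟩, fun z hz =>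
      (le_sSup hz).trans (Subgroup.le_topologicalClosure _)⟩
    · exact (Subgroup.isClosed_topologicalClosure _).isCompact
    · have h1 : ((sSup c : Subgroup G) : Set G) = ⋃₀ ((fun s : Subgroup G => (s : Set G)) '' c) := by
        ext x
        simp [hmem]
      have h2 : IsConnected ((sSup c : Subgroup G) : Set G) := by
        refine ⟨⟨1, Subgroup.one_mem _⟩, ?_⟩
        rw [h1]
        refine isPreconnected_sUnion 1 _ ?_ ?_
        · rintro _ ⟨s, -, rfl⟩
          exact s.one_mem
        · rintro _ ⟨s, hs, rfl⟩
          exact (hc hs).connected.isPreconnected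
      exact h2.closure
    · have hcomm : ∀ a b : (sSup c : Subgroup G), a * b = b * a := by
        rintro ⟨a, ha⟩ ⟨b, hb⟩
        obtain ⟨s, hs, has⟩ := hmem.1 ha
        obtain ⟨s', hs', hbs'⟩ := hmem.1 hb
        obtain ⟨r, hr, h1, h2⟩ := hdir s hs s' hs'
        exact Subtype.ext ((hc hr).comm a (h1 has) b (h2 hbs'))
      intro a ha b hb
      exact congrArg Subtype.val
        (((sSup c).commGroupTopologicalClosure hcomm).mul_comm ⟨a, ha⟩ ⟨b, hb⟩)) T₀ hT₀
  exact ⟨T, hT, hle⟩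

/-- Surjectivity of the exponential map of a compact connected subgroup of `G`. -/
lemma exists_mem_lieAlg_exp_eq {H : Subgroup G} (hH : IsCompact (H : Set G))
    (hconn : IsPreconnected (H : Set G)) {g : G} (hg : g ∈ H) :
    ∃ X ∈ lieAlg H, exp X = mat g := by
  have hset : ((H.map G.subtype : Subgroup (GL (Fin n) ℂ)) : Set (GL (Fin n) ℂ)) =
      Subtype.val '' (H : Set G) := rfl
  obtain ⟨X, hX, hXg⟩ := exists_exp_eq_of_isCompact (H.map G.subtype)
    (hset ▸ hH.image continuous_subtype_val)
    (hset ▸ hconn.image _ continuous_subtype_val.continuousOn) (g := g) ⟨g, hg, rfl⟩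
  refine ⟨X, fun t => ?_, hXg⟩
  obtain ⟨_, ⟨a, ha, rfl⟩, hae⟩ := hX t
  exact ⟨a, ha, hae⟩

/-- Every element of a compact connected group lies in a maximal torus. -/
theorem exists_isMaximalTorus_mem (hG : IsCompact (G : Set (GL (Fin n) ℂ)))
    (hconn : IsConnected (G : Set (GL (Fin n) ℂ))) (g : G) :
    ∃ T : Subgroup G, IsMaximalTorus T ∧ g ∈ T := by
  have : CompactSpace G := isCompact_iff_compactSpace.1 hG
  have : ConnectedSpace G := isConnected_iff_connectedSpace.1 hconn
  obtain ⟨X, hX, hXg⟩ := exists_mem_lieAlg_exp_eq (H := (⊤ : Subgroup G)) isCompact_univ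
    isPreconnected_univ (Subgroup.mem_top g)
  obtain ⟨ρ, hρ, hρX⟩ := exists_oneParam hX
  obtain ⟨T₀, hT₀, hmem⟩ := exists_isTorus_of_oneParam hG hρ 1
  have hg : ρ (.ofAdd 1) = g := mat_injective (by rw [(hρX 1).2, one_smul, hXg])
  obtain ⟨T, hT, hle⟩ := hT₀.exists_le_isMaximalTorus hG
  exact ⟨T, hT, hle (hg ▸ hmem)⟩

/-- A one-parameter group with `exp (2π ξ) = 1` descends to an algebraic homomorphism from the
circle. -/
lemma exists_loop_of_periodic {H : Subgroup G} {ξ : Matrix (Fin n) (Fin n) ℂ} (hξ : ξ ∈ lieAlg H)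
    (hper : exp ((2 * Real.pi) • ξ) = 1) :
    ∃ γ : Circle → G, (∀ t : ℝ, mat (γ (Circle.exp t)) = exp (t • ξ)) ∧
      (∀ a b, γ (a * b) = γ a * γ b) ∧ HasEntriesIn trigAlgebra γ := by
  obtain ⟨ρ, -, hρ⟩ := exists_oneParam hξ
  have h2pi : ρ (.ofAdd (2 * Real.pi)) = 1 :=
    mat_injective (by rw [(hρ _).2, hper, mat_one])
  have hwd : ∀ t : ℝ, ρ (.ofAdd (Complex.arg (Circle.exp t))) = ρ (.ofAdd t) := by
    intro t
    obtain ⟨m, hm⟩ := Circle.exp_eq_exp.1 (Circle.exp_arg (Circle.exp t))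
    have : (Multiplicative.ofAdd (Complex.arg (Circle.exp t)) : Multiplicative ℝ) =
        .ofAdd t * (.ofAdd (2 * Real.pi)) ^ m := by
      rw [hm, ofAdd_add, ← ofAdd_zsmul, zsmul_eq_mul]
    rw [this, map_mul, map_zpow, h2pi, one_zpow, mul_one]
  -- The argument is discontinuous at `-1`, but `ρ ∘ arg` is not affected by its jump of `2π`.
  set γ : Circle → G := fun l => ρ (.ofAdd (Complex.arg l)) with hγ
  have hγe : ∀ t : ℝ, γ (Circle.exp t) = ρ (.ofAdd t) := hwd
  have hγm : ∀ t : ℝ, mat (γ (Circle.exp t)) = exp (t • ξ) := fun t => by rw [hγe, (hρ t).2]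
  refine ⟨γ, hγm, fun a b => ?_, fun i j => ?_⟩
  · rw [← Circle.exp_arg a, ← Circle.exp_arg b, ← Circle.exp_add, hγe, hγe, hγe, ofAdd_add, map_mul]
  · have hsm : ∀ t : ℝ, (t : ℂ) • ξ = t • ξ := fun t => Complex.coe_smul t ξ
    have hper' : exp ((2 * Real.pi : ℂ) • ξ) = 1 := by
      rw [← hper, ← hsm]
      push_cast
      rfl
    obtain ⟨p, hp⟩ : ∃ p : ℤ →₀ Matrix (Fin n) (Fin n) ℂ, ∀ t : ℂ, exp (t • ξ) =
        p.sum fun k c => Complex.exp (t * Complex.I) ^ k • c :=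
      open scoped Matrix.Norms.Operator in exists_exp_smul_eq_sum hper'
    have : (fun l => mat (γ l) i j) = ∑ k ∈ p.support, p k i j • circleMonomial k := by
      ext l
      obtain ⟨t, rfl⟩ : ∃ t : ℝ, Circle.exp t = l := ⟨_, Circle.exp_arg l⟩
      rw [hγm, ← hsm, hp, Finsupp.sum, Matrix.sum_apply, Finset.sum_apply]
      simp [circleMonomial, Circle.coe_exp, mul_comm]
    rw [this]
    exact sum_mem fun k _ => trigAlgebra.smul_mem (circleMonomial_mem_trigAlgebra k) _

end Tori

/-! ### Wirtinger derivatives of matrix valued maps -/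

noncomputable section Wirtinger

variable {n : ℕ} {G : Subgroup (GL (Fin n) ℂ)}

/-- Entrywise real differentiability of a matrix valued map. -/
def EntryDiff (f : ℂ → Matrix (Fin n) (Fin n) ℂ) (x : ℂ) : Prop :=
  ∀ i j, DifferentiableAt ℝ (fun y => f y i j) x

/-- The operator `(∂_x + ε ∂_y) / 2`, entry by entry; it is `∂_z` for `ε = -i` and `∂_z̄` for
`ε = i`, which allows both to be treated at once. -/
def wirtinger (ε : ℂ) (f : ℂ → Matrix (Fin n) (Fin n) ℂ) (x : ℂ) : Matrix (Fin n) (Fin n) ℂ :=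
  Matrix.of fun i j => (1 / 2 : ℂ) *
    (fderiv ℝ (fun y => f y i j) x 1 + ε * fderiv ℝ (fun y => f y i j) x Complex.I)

lemma wirtinger_neg_I (f : ℂ → Matrix (Fin n) (Fin n) ℂ) (x : ℂ) :
    wirtinger (-Complex.I) f x = dz f x := by
  ext i j
  simp [wirtinger, dz, sub_eq_add_neg]

lemma wirtinger_I (f : ℂ → Matrix (Fin n) (Fin n) ℂ) (x : ℂ) :
    wirtinger Complex.I f x = dzbar f x := rfl

variable {f g : ℂ → Matrix (Fin n) (Fin n) ℂ} {x : ℂ} {ε : ℂ}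

lemma wirtinger_congr (h : f =ᶠ[𝓝 x] g) : wirtinger ε f x = wirtinger ε g x := by
  ext i j
  have : (fun y => f y i j) =ᶠ[𝓝 x] fun y => g y i j := h.mono fun y hy => congrFun (congrFun hy i) j
  simp only [wirtinger, Matrix.of_apply, this.fderiv_eq]

lemma EntryDiff.congr (hf : EntryDiff f x) (h : f =ᶠ[𝓝 x] g) : EntryDiff g x := fun i j =>
  (hf i j).congr_of_eventuallyEq (h.mono fun _ hy => (congrFun (congrFun hy i) j).symm)

lemma entryDiff_const (A : Matrix (Fin n) (Fin n) ℂ) : EntryDiff (fun _ => A) x := fun _ _ =>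
  differentiableAt_const _

lemma wirtinger_const (A : Matrix (Fin n) (Fin n) ℂ) : wirtinger ε (fun _ => A) x = 0 := by
  ext i j
  simp [wirtinger]

lemma EntryDiff.mul (hf : EntryDiff f x) (hg : EntryDiff g x) :
    EntryDiff (fun y => f y * g y) x := fun i j => by
  simp only [Matrix.mul_apply]
  exact DifferentiableAt.fun_sum fun k _ => (hf i k).mul (hg k j)

/-- The Leibniz rule. -/
lemma wirtinger_mul (hf : EntryDiff f x) (hg : EntryDiff g x) :
    wirtinger ε (fun y => f y * g y) x = wirtinger ε f x * g x + f x * wirtinger ε g x := by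
  have key : ∀ i j v, fderiv ℝ (fun y => (f y * g y) i j) x v =
      ∑ k, (fderiv ℝ (fun y => f y i k) x v * g x k j + f x i k * fderiv ℝ (fun y => g y k j) x v) := by
    intro i j v
    have h1 : HasFDerivAt (fun y => ∑ k, f y i k * g y k j)
        (∑ k, (f x i k • fderiv ℝ (fun y => g y k j) x + g x k j • fderiv ℝ (fun y => f y i k) x)) x :=
      HasFDerivAt.fun_sum fun k _ => (hf i k).hasFDerivAt.mul (hg k j).hasFDerivAt
    have h2 : (fun y => (f y * g y) i j) = fun y => ∑ k, f y i k * g y k j :=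
      funext fun y => Matrix.mul_apply
    rw [h2, h1.fderiv, _root_.sum_apply]
    refine Finset.sum_congr rfl fun k _ => ?_
    simp only [_root_.add_apply, _root_.smul_apply, smul_eq_mul]
    ring
  ext i j
  rw [Matrix.add_apply, Matrix.mul_apply, Matrix.mul_apply]
  simp only [wirtinger, Matrix.of_apply]
  rw [key, key]
  rw [← Finset.sum_add_distrib, Finset.mul_sum, ← Finset.sum_add_distrib, Finset.mul_sum]
  refine Finset.sum_congr rfl fun k _ => ?_
  ring

lemma fderiv_comp_holomorphic {q φ : ℂ → ℂ} {q' : ℂ} (hq : HasDerivAt q q' x)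
    (hφ : DifferentiableAt ℝ φ (q x)) (v : ℂ) :
    fderiv ℝ (fun y => φ (q y)) x v =
      (v * q').re * fderiv ℝ φ (q x) 1 + (v * q').im * fderiv ℝ φ (q x) Complex.I := by
  have h1 := (hφ.hasFDerivAt.comp x (hq.hasFDerivAt.restrictScalars ℝ)).fderiv
  have h2 : (fun y => φ (q y)) = φ ∘ q := rfl
  have h3 : v * q' = (v * q').re • (1 : ℂ) + (v * q').im • Complex.I := by
    apply Complex.ext <;> simp
  have h4 : fderiv ℝ (fun y => φ (q y)) x v = fderiv ℝ φ (q x) (v * q') := by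
    rw [h2, h1]
    simp
  rw [h4]
  conv_lhs => rw [h3]
  rw [map_add, map_smul, map_smul, Complex.real_smul, Complex.real_smul]

/-- Holomorphic change of coordinates for `∂_z`. -/
lemma dz_comp {q : ℂ → ℂ} {q' : ℂ} (hq : HasDerivAt q q' x) (hf : EntryDiff f (q x)) :
    dz (fun y => f (q y)) x = q' • dz f (q x) := by
  ext i j
  simp only [dz, Matrix.of_apply, Matrix.smul_apply, smul_eq_mul]
  rw [fderiv_comp_holomorphic hq (hf i j), fderiv_comp_holomorphic hq (hf i j)]
  have hI := Complex.I_sq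
  have hq' := (Complex.re_add_im q').symm
  simp only [one_mul, Complex.I_mul_re, Complex.I_mul_im, Complex.ofReal_neg]
  set T := fderiv ℝ (fun y => f y i j) (q x)
  linear_combination -(1 / 2) * (T 1 - Complex.I * T Complex.I) * hq' +
    (1 / 2) * (q'.im : ℂ) * T Complex.I * hI

/-- Holomorphic change of coordinates for `∂_z̄`. -/
lemma dzbar_comp {q : ℂ → ℂ} {q' : ℂ} (hq : HasDerivAt q q' x) (hf : EntryDiff f (q x)) :
    dzbar (fun y => f (q y)) x = star q' • dzbar f (q x) := by
  ext i j
  simp only [dzbar, Matrix.of_apply, Matrix.smul_apply, smul_eq_mul]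
  rw [fderiv_comp_holomorphic hq (hf i j), fderiv_comp_holomorphic hq (hf i j)]
  have hI := Complex.I_sq
  have hq' : star q' = q'.re - q'.im * Complex.I := by
    apply Complex.ext <;> simp
  simp only [one_mul, Complex.I_mul_re, Complex.I_mul_im, Complex.ofReal_neg]
  set T := fderiv ℝ (fun y => f y i j) (q x)
  linear_combination -(1 / 2) * (T 1 + Complex.I * T Complex.I) * hq' +
    (1 / 2) * (q'.im : ℂ) * T Complex.I * hI

/-- A map with vanishing Wirtinger derivatives near a point is constant near that point. -/
lemma eventually_eq_of_wirtinger_eq_zero (hf : ∀ᶠ y in 𝓝 x, EntryDiff f y)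
    (h1 : ∀ᶠ y in 𝓝 x, dz f y = 0) (h2 : ∀ᶠ y in 𝓝 x, dzbar f y = 0) :
    ∀ᶠ y in 𝓝 x, f y = f x := by
  obtain ⟨r, hr, hball⟩ := Metric.eventually_nhds_iff_ball.1 (hf.and (h1.and h2))
  filter_upwards [Metric.ball_mem_nhds x hr] with _ hy
  ext i j
  refine (convex_ball x r).is_const_of_fderivWithin_eq_zero (𝕜 := ℝ) (f := fun y => f y i j)
    (fun z hz => ((hball z hz).1 i j).differentiableWithinAt) (fun z hz => ?_) hy
    (Metric.mem_ball_self hr)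
  rw [fderivWithin_of_isOpen Metric.isOpen_ball hz]
  have e1 := congrFun (congrFun (hball z hz).2.1 i) j
  have e2 := congrFun (congrFun (hball z hz).2.2 i) j
  simp only [dz, dzbar, Matrix.of_apply, Matrix.zero_apply] at e1 e2
  set T := fderiv ℝ (fun y => f y i j) z
  have hT1 : T 1 = 0 := by linear_combination e1 + e2
  have hTI : T Complex.I = 0 := by
    have hI := Complex.I_sq
    linear_combination Complex.I * e1 - Complex.I * e2 + T Complex.I * hI
  ext v
  have : v = v.re • (1 : ℂ) + v.im • Complex.I := by
    apply Complex.ext <;> simp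
  rw [this, map_add, map_smul, map_smul, hT1, hTI]
  simp

variable {u v : ℂ → G}

lemma EntryDiff.mat_inv (hG : IsCompact (G : Set (GL (Fin n) ℂ)))
    (hu : EntryDiff (fun y => mat (u y)) x) : EntryDiff (fun y => mat (u y)⁻¹) x := by
  obtain ⟨P, P', hP⟩ := exists_inv_eq hG
  simp only [hP]
  refine EntryDiff.mul (EntryDiff.mul (entryDiff_const P') fun i j => ?_) (entryDiff_const P)
  exact (hu j i).star

/-- The coefficient of the Maurer-Cartan form `f⁻¹ df` belonging to the operator `wirtinger ε`: that
of `dz` for `ε = -i` and that of `dz̄` for `ε = i`. -/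
def mcForm (ε : ℂ) (f : ℂ → G) (x : ℂ) : Matrix (Fin n) (Fin n) ℂ :=
  mat (f x)⁻¹ * wirtinger ε (fun y => mat (f y)) x

lemma wirtinger_mat_inv (hG : IsCompact (G : Set (GL (Fin n) ℂ)))
    (hu : EntryDiff (fun y => mat (u y)) x) :
    wirtinger ε (fun y => mat (u y)⁻¹) x = -(mcForm ε u x * mat (u x)⁻¹) := by
  have h1 : wirtinger ε (fun y => mat (u y) * mat (u y)⁻¹) x = 0 := by
    simp only [mat_mul_mat_inv]
    exact wirtinger_const 1
  rw [wirtinger_mul hu (hu.mat_inv hG)] at h1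
  have h2 := congrArg (fun A => mat (u x)⁻¹ * A) h1
  simp only [mul_add, mul_zero, ← mul_assoc, mat_inv_mul_mat, one_mul] at h2
  exact eq_neg_of_add_eq_zero_right h2

lemma wirtinger_mat (u : ℂ → G) : wirtinger ε (fun y => mat (u y)) x = mat (u x) * mcForm ε u x := by
  rw [mcForm, ← mul_assoc, mat_mul_mat_inv, one_mul]

/-- With `𝔽 = u h u⁻¹`, the form `½ 𝔽⁻¹ d𝔽` is minus the conjugate by `u` of the `𝔭`-part of
`u⁻¹ du`. -/
lemma half_mcForm_conj (hG : IsCompact (G : Set (GL (Fin n) ℂ))) {h : G} (hh : h * h = 1)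
    (hu : EntryDiff (fun y => mat (u y)) x) :
    (1 / 2 : ℂ) • mcForm ε (fun y => u y * h * (u y)⁻¹) x =
      -(mat (u x) * pPart h (mcForm ε u x) * mat (u x)⁻¹) := by
  have hinv : h⁻¹ = h := inv_eq_of_mul_eq_one_left hh
  have h1 : wirtinger ε (fun y => mat (u y * h * (u y)⁻¹)) x =
      mat (u x) * (mcForm ε u x * mat h - mat h * mcForm ε u x) * mat (u x)⁻¹ := by
    simp only [mat_mul]
    rw [wirtinger_mul (hu.mul (entryDiff_const _)) (hu.mat_inv hG),
      wirtinger_mul hu (entryDiff_const _), wirtinger_const, wirtinger_mat_inv hG hu, wirtinger_mat]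
    noncomm_ring
  have h2 : mat (u x * h * (u x)⁻¹)⁻¹ = mat (u x) * mat h * mat (u x)⁻¹ := by
    rw [← mat_mul, ← mat_mul]
    congr 1
    rw [mul_inv_rev, mul_inv_rev, inv_inv, hinv, mul_assoc]
  rw [mcForm, h1, h2, pPart, hinv]
  have e1 : mat (u x)⁻¹ * mat (u x) = 1 := mat_inv_mul_mat _
  have e2 : mat h * mat h = 1 := by rw [← mat_mul, hh, mat_one]
  calc (1 / 2 : ℂ) • (mat (u x) * mat h * mat (u x)⁻¹ *
        (mat (u x) * (mcForm ε u x * mat h - mat h * mcForm ε u x) * mat (u x)⁻¹))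
      = (1 / 2 : ℂ) • (mat (u x) * mat h * (mat (u x)⁻¹ * mat (u x)) *
        (mcForm ε u x * mat h - mat h * mcForm ε u x) * mat (u x)⁻¹) := by
        simp only [mul_assoc]
    _ = (1 / 2 : ℂ) • (mat (u x) * (mat h * mcForm ε u x * mat h -
          (mat h * mat h) * mcForm ε u x) * mat (u x)⁻¹) := by
        rw [e1]
        congr 1
        noncomm_ring
    _ = _ := by
        rw [e2, one_mul]
        simp only [mul_smul_comm, smul_mul_assoc, ← smul_neg]
        congr 1
        noncomm_ring

/-- If `V` and `u u₁⁻¹` satisfy the same linear equation, then the derivative of the quotient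
`V u₁ u⁻¹` vanishes. The parameter `c` is `λ⁻¹` for `∂_z` and `λ` for `∂_z̄`. -/
lemma wirtinger_quotient_eq_zero (hG : IsCompact (G : Set (GL (Fin n) ℂ))) {h : G} (hh : h * h = 1)
    {u₁ u V : ℂ → G} {c : ℂ} (hu₁ : EntryDiff (fun y => mat (u₁ y)) x)
    (hu : EntryDiff (fun y => mat (u y)) x) (hV : EntryDiff (fun y => mat (V y)) x)
    (hmc : mcForm ε u x = c • pPart h (mcForm ε u₁ x) + kPart h (mcForm ε u₁ x))
    (hVeq : wirtinger ε (fun y => mat (V y)) x =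
      (1 - c) • (mat (V x) * ((1 / 2 : ℂ) • mcForm ε (fun y => u₁ y * h * (u₁ y)⁻¹) x))) :
    wirtinger ε (fun y => mat (V y * u₁ y * (u y)⁻¹)) x = 0 := by
  have hsplit : mcForm ε u₁ x = kPart h (mcForm ε u₁ x) + pPart h (mcForm ε u₁ x) := by
    rw [kPart, pPart]
    module
  have e1 : mat (u₁ x)⁻¹ * mat (u₁ x) = 1 := mat_inv_mul_mat _
  simp only [mat_mul]
  rw [wirtinger_mul (hV.mul hu₁) (hu.mat_inv hG), wirtinger_mul hV hu₁, hVeq,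
    half_mcForm_conj hG hh hu₁, wirtinger_mat_inv hG hu, wirtinger_mat, hmc]
  set α := mcForm ε u₁ x
  have e2 : (1 - c) • (mat (V x) * -(mat (u₁ x) * pPart h α * mat (u₁ x)⁻¹)) * mat (u₁ x) =
      (c - 1) • (mat (V x) * mat (u₁ x) * pPart h α) := by
    rw [mul_neg, smul_neg, ← neg_smul, neg_sub, smul_mul_assoc]
    congr 1
    simp only [mul_assoc]
    rw [e1, mul_one]
  have e3 : mat (u₁ x) * α = mat (u₁ x) * (kPart h α + pPart h α) := by rw [← hsplit]
  rw [e2, e3]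
  generalize pPart h α = p
  generalize kPart h α = k
  generalize mat (V x) = v
  generalize mat (u₁ x) = b
  generalize mat (u x)⁻¹ = d
  have e4 : c • (v * b * p) = v * b * (c • p) := (mul_smul_comm _ _ _).symm
  rw [sub_smul, one_smul, e4]
  noncomm_ring

end Wirtinger

/-! ### Functions that are locally constant off a finite set -/

section PuncturedContinuation

lemma isPreconnected_punctured_ball (x : ℂ) (r : ℝ) :
    IsPreconnected (Metric.ball x r \ {x}) := by
  have himage : (fun p : ℝ × ℝ => x + p.1 * Complex.exp (p.2 * Complex.I)) ''
      (Set.Ioo 0 r ×ˢ Set.univ) = Metric.ball x r \ {x} := by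
    ext y
    constructor
    · rintro ⟨⟨ρ, θ⟩, ⟨hρ, -⟩, rfl⟩
      refine ⟨?_, ?_⟩
      · simpa [Complex.norm_exp_ofReal_mul_I, abs_of_pos hρ.1] using hρ.2
      · simpa using hρ.1.ne'
    · rintro ⟨hy, hyx⟩
      refine ⟨(‖y - x‖, Complex.arg (y - x)), ⟨⟨norm_pos_iff.2 (sub_ne_zero.2 hyx), ?_⟩, trivial⟩, ?_⟩
      · rwa [Metric.mem_ball, dist_eq_norm] at hy
      · simp only [Complex.norm_mul_exp_arg_mul_I]
        ring
  rw [← himage]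
  exact (isPreconnected_Ioo.prod isPreconnected_univ).image _ (by fun_prop)

variable {N X : Type*} [TopologicalSpace N] [ChartedSpace ℂ N]

lemma nhdsNE_neBot_of_chartedSpace (z : N) : (𝓝[≠] z).NeBot := by
  by_contra hz
  rw [not_neBot, ← isOpen_singleton_iff_punctured_nhds] at hz
  have h1 := (chartAt ℂ z).isOpen_image_of_subset_source hz
    (Set.singleton_subset_iff.2 (mem_chart_source ℂ z))
  rw [Set.image_singleton] at h1
  exact not_isOpen_singleton _ h1

/-- Near any point of a surface, a function that is locally constant off a finite set takes a single
value at all other points, because punctured discs are connected. -/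
lemma exists_eventually_nhdsNE_eq [T1Space N] {S : Set N} (hS : S.Finite) {D : N → X}
    (hD : ∀ z ∉ S, ∀ᶠ y in 𝓝 z, D y = D z) (z : N) : ∃ c, ∀ᶠ y in 𝓝[≠] z, D y = c := by
  set φ := chartAt ℂ z
  have hz : z ∈ φ.source := mem_chart_source ℂ z
  have hφz : φ.symm (φ z) = z := φ.left_inv hz
  have hcont : ContinuousAt φ.symm (φ z) := φ.continuousAt_symm (φ.map_source hz)
  have hev : ∀ᶠ y in 𝓝 (φ z), y ∈ φ.target ∧ φ.symm y ∈ (S \ {z})ᶜ :=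
    (φ.open_target.eventually_mem (φ.map_source hz)).and
      (hcont.preimage_mem_nhds ((hS.subset Set.sdiff_subset).isClosed.isOpen_compl.mem_nhds
        (by simp [hφz])))
  obtain ⟨r, hr, hball⟩ := Metric.eventually_nhds_iff_ball.1 hev
  have hnotMem : ∀ y ∈ Metric.ball (φ z) r \ {φ z}, φ.symm y ∉ S := fun y hy hyS =>
    (hball y hy.1).2 ⟨hyS, fun h => hy.2 (by
      rw [Set.mem_singleton_iff, ← h, φ.right_inv (hball y hy.1).1])⟩
  have hconst : ∀ a ∈ Metric.ball (φ z) r \ {φ z}, ∀ b ∈ Metric.ball (φ z) r \ {φ z},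
      D (φ.symm a) = D (φ.symm b) := fun a ha b hb =>
    (isPreconnected_punctured_ball (φ z) r).induction₂ (fun a b => D (φ.symm a) = D (φ.symm b))
      (fun y hy => nhdsWithin_le_nhds
        (((φ.continuousAt_symm (hball y hy.1).1).eventually (hD _ (hnotMem y hy))).mono
          fun _ h => h.symm)) (fun _ _ _ _ _ _ => Eq.trans) (fun _ _ _ _ => Eq.symm) ha hb
  have h1 : ∀ᶠ y in 𝓝[≠] z, φ y ∈ Metric.ball (φ z) r \ {φ z} := by
    rw [eventually_nhdsWithin_iff]
    filter_upwards [φ.open_source.mem_nhds hz,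
      (φ.continuousAt hz).preimage_mem_nhds (Metric.ball_mem_nhds _ hr)] with y hy hy' hne
    exact ⟨hy', fun h => hne (φ.injOn hy hz h)⟩
  have h2 : ∀ᶠ y in 𝓝[≠] z, y ∈ φ.source := nhdsWithin_le_nhds (φ.open_source.mem_nhds hz)
  have := nhdsNE_neBot_of_chartedSpace z
  obtain ⟨a, ha, ha'⟩ := (h1.and h2).exists
  refine ⟨D a, ?_⟩
  filter_upwards [h1, h2] with y hy hy'
  have := hconst _ hy _ ha
  rwa [φ.left_inv hy', φ.left_inv ha'] at this

/-- A function on a connected surface that is locally constant off a finite set is constant off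
that set. -/
lemma eq_of_locally_constant_compl_finite [T1Space N] [PreconnectedSpace N] {S : Set N}
    (hS : S.Finite) {D : N → X} (hD : ∀ z ∉ S, ∀ᶠ y in 𝓝 z, D y = D z) {a b : N} (ha : a ∉ S)
    (hb : b ∉ S) : D b = D a := by
  have hne : ∀ z : N, (𝓝[≠] z).NeBot := nhdsNE_neBot_of_chartedSpace
  set P : Set N := {z | ∀ᶠ y in 𝓝[≠] z, D y = D a}
  -- `P` is open and closed, and it contains `a`.
  have hopen : IsOpen P := by
    refine isOpen_iff_mem_nhds.2 fun z hz => ?_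
    have h1 := eventually_eventually_nhdsWithin.2 hz
    rw [eventually_nhdsWithin_iff] at h1
    filter_upwards [h1] with y hy
    by_cases hyz : y = z
    · exact hyz ▸ hz
    · have h2 : ∀ᶠ y in 𝓝 y, D y = D a := by
        have := hy hyz
        rwa [isOpen_compl_singleton.nhdsWithin_eq hyz] at this
      exact nhdsWithin_le_nhds h2
  have hclosed : IsClosed P := by
    refine isClosed_of_closure_subset fun z hz => ?_
    obtain ⟨c, hc⟩ := exists_eventually_nhdsNE_eq hS hD z
    rw [eventually_nhdsWithin_iff, eventually_nhds_iff] at hc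
    obtain ⟨U, hU, hUo, hzU⟩ := hc
    obtain ⟨z', hz'U, hz'P⟩ := mem_closure_iff.1 hz U hUo hzU
    by_cases hzz : z' = z
    · exact hzz ▸ hz'P
    have h3 : ∀ᶠ y in 𝓝[≠] z', y ∈ U ∧ y ≠ z := nhdsWithin_le_nhds
      ((hUo.eventually_mem hz'U).and (isOpen_compl_singleton.eventually_mem hzz))
    obtain ⟨y, hy, hyU, hyz⟩ := (Eventually.and (show ∀ᶠ y in 𝓝[≠] z', D y = D a from hz'P) h3).exists
    have hca : c = D a := (hU y hyU hyz).symm.trans hy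
    change ∀ᶠ y in 𝓝[≠] z, D y = D a
    rw [eventually_nhdsWithin_iff]
    filter_upwards [hUo.mem_nhds hzU] with y hy hyz
    exact (hU y hy hyz).trans hca
  have hP : P = Set.univ := IsClopen.eq_univ ⟨hclosed, hopen⟩ ⟨a, nhdsWithin_le_nhds (hD a ha)⟩
  have hbP : ∀ᶠ y in 𝓝[≠] b, D y = D a := (hP ▸ Set.mem_univ b : b ∈ P)
  obtain ⟨y, hy, hy'⟩ := (hbP.and (nhdsWithin_le_nhds (hD b hb))).exists
  exact hy'.symm.trans hy

lemma dense_compl_finite_of_chartedSpace [T1Space N] {S : Set N} (hS : S.Finite) : Dense Sᶜ := by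
  have : ∀ z : N, (𝓝[≠] z).NeBot := nhdsNE_neBot_of_chartedSpace
  exact dense_univ.sdiff_finite hS |>.mono fun z hz => hz.2

end PuncturedContinuation

/-! ### Extended solutions in local coordinates -/

noncomputable section Surfaces

variable {n : ℕ} {G : Subgroup (GL (Fin n) ℂ)}
variable {M : Type*} [TopologicalSpace M] [ChartedSpace ℂ M]

lemma SmoothInto.continuous_mat {f : M → G} (hf : SmoothInto f Set.univ) :
    Continuous fun p => mat (f p) :=
  continuous_matrix fun i j => (contMDiffOn_univ.1 (hf i j)).continuous

variable [IsManifold 𝓘(ℂ) ω M]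

variable (M) in
/-- The real smooth structure underlying a complex one. -/
lemma isManifold_real : IsManifold 𝓘(ℝ, ℂ) ∞ M := by
  refine isManifold_of_contDiffOn 𝓘(ℝ, ℂ) ∞ M fun e e' he he' => ?_
  have h1 := (mem_groupoid_of_pregroupoid.1
    (HasGroupoid.compatible (G := contDiffGroupoid ω 𝓘(ℂ)) he he')).1
  exact (h1.restrict_scalars ℝ).of_le le_top

lemma SmoothInto.entryDiff {f : M → G} {U : Set M} (hf : SmoothInto f U) (hU : IsOpen U)
    {φ : OpenPartialHomeomorph M ℂ} (hφ : φ ∈ atlas ℂ M) {x : ℂ} (hx : x ∈ φ.target)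
    (hxU : φ.symm x ∈ U) : EntryDiff (fun y => mat (f (φ.symm y))) x := fun i j => by
  have := isManifold_real M
  have h1 := (hf i j).contMDiffAt (hU.mem_nhds hxU)
  have h2 : ContMDiffAt 𝓘(ℝ, ℂ) 𝓘(ℝ, ℂ) ∞ φ.symm x :=
    (contMDiffOn_symm_of_mem_maximalAtlas (I := 𝓘(ℝ, ℂ)) (n := ∞)
      (IsManifold.subset_maximalAtlas hφ)).contMDiffAt (φ.open_target.mem_nhds hx)
  exact (contMDiffAt_iff_contDiffAt.1 (h1.comp x h2)).differentiableAt (by simp)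

variable {N : Type*} [TopologicalSpace N] [ChartedSpace ℂ N] [IsManifold 𝓘(ℂ) ω N]

lemma exists_hasDerivAt_transition {π : N → M} (hπ : MDifferentiable 𝓘(ℂ) 𝓘(ℂ) π)
    {φ : OpenPartialHomeomorph M ℂ} (hφ : φ ∈ atlas ℂ M)
    {ψ : OpenPartialHomeomorph N ℂ} (hψ : ψ ∈ atlas ℂ N) {y : ℂ} (hy : y ∈ ψ.target)
    (hyφ : π (ψ.symm y) ∈ φ.source) : ∃ q', HasDerivAt (fun t => φ (π (ψ.symm t))) q' y := by
  have h1 := mdifferentiableAt_atlas_symm (I := 𝓘(ℂ)) hψ hy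
  have h2 := mdifferentiableAt_atlas (I := 𝓘(ℂ)) hφ hyφ
  have h3 := h2.comp y ((hπ _).comp y h1)
  exact ⟨_, (mdifferentiableAt_iff_differentiableAt.1 h3).hasDerivAt⟩

/-- The equations of an extended solution pull back along holomorphic maps: both sides are multiplied
by the derivative `q'` of the coordinate expression of `π`, or by its conjugate. -/
lemma IsExtendedSolution.pullback {w : ℤ → ℝ} {𝔽 : M → G} {Φ : M → Circle → G}
    (hΦ : IsExtendedSolution w 𝔽 Φ) {π : N → M} (hπ : MDifferentiable 𝓘(ℂ) 𝓘(ℂ) π)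
    {ψ : OpenPartialHomeomorph N ℂ} (hψ : ψ ∈ atlas ℂ N) {y : ℂ} (hy : y ∈ ψ.target)
    (l : Circle) :
    EntryDiff (fun t => mat (Φ (π (ψ.symm t)) l)) y ∧
    dz (fun t => mat (Φ (π (ψ.symm t)) l)) y = (1 - (l : ℂ)⁻¹) • (mat (Φ (π (ψ.symm y)) l) *
      ((1 / 2 : ℂ) • mcZ (fun t => 𝔽 (π (ψ.symm t))) y)) ∧
    dzbar (fun t => mat (Φ (π (ψ.symm t)) l)) y = (1 - (l : ℂ)) • (mat (Φ (π (ψ.symm y)) l) *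
      ((1 / 2 : ℂ) • mcZbar (fun t => 𝔽 (π (ψ.symm t))) y)) := by
  set φ := chartAt ℂ (π (ψ.symm y))
  have hφ : φ ∈ atlas ℂ M := chart_mem_atlas ℂ _
  have hsrc : π (ψ.symm y) ∈ φ.source := mem_chart_source ℂ _
  obtain ⟨q', hq⟩ := exists_hasDerivAt_transition hπ hφ hψ hy hsrc
  set q : ℂ → ℂ := fun t => φ (π (ψ.symm t))
  have hev : ∀ᶠ t in 𝓝 y, φ.symm (q t) = π (ψ.symm t) := by
    have hc : ContinuousAt (fun t => π (ψ.symm t)) y :=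
      (hπ _).continuousAt.comp (ψ.continuousAt_symm hy)
    filter_upwards [hc.preimage_mem_nhds (φ.open_source.mem_nhds hsrc)] with t ht
    exact φ.left_inv ht
  have hqy : φ.symm (q y) = π (ψ.symm y) := φ.left_inv hsrc
  have htar : q y ∈ φ.target := φ.map_source hsrc
  have hdiff : ∀ l, EntryDiff (fun s => mat (Φ (φ.symm s) l)) (q y) := fun l =>
    (hΦ.smooth l).entryDiff isOpen_univ hφ htar trivial
  have hcongr : ∀ l, (fun t => mat (Φ (π (ψ.symm t)) l)) =ᶠ[𝓝 y]
      fun t => mat (Φ (φ.symm (q t)) l) := fun l => hev.mono fun t ht => by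
    simp only [ht]
  have hcomp : ∀ l, EntryDiff (fun t => mat (Φ (φ.symm (q t)) l)) y := fun l i j =>
    (hdiff l i j).comp y (hq.hasFDerivAt.restrictScalars ℝ).differentiableAt
  have hz : ∀ l, dz (fun t => mat (Φ (π (ψ.symm t)) l)) y =
      q' • dz (fun s => mat (Φ (φ.symm s) l)) (q y) := fun l => by
    rw [← wirtinger_neg_I, wirtinger_congr (hcongr l), wirtinger_neg_I, ← dz_comp hq (hdiff l)]
  have hzbar : ∀ l, dzbar (fun t => mat (Φ (π (ψ.symm t)) l)) y =
      star q' • dzbar (fun s => mat (Φ (φ.symm s) l)) (q y) := fun l => by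
    rw [← wirtinger_I, wirtinger_congr (hcongr l), wirtinger_I, ← dzbar_comp hq (hdiff l)]
  have h𝔽 : 𝔽 = fun p => Φ p (-1) := funext fun p => (hΦ.eval_neg_one p).symm
  refine ⟨(hcomp l).congr (hcongr l).symm, ?_, ?_⟩
  · have e : mcZ (fun t => 𝔽 (π (ψ.symm t))) y = q' • mcZ (𝔽 ∘ φ.symm) (q y) := by
      simp only [mcZ, Function.comp_apply, hqy, h𝔽]
      rw [hz, mul_smul_comm]
    rw [hz, hΦ.eq_z φ hφ _ htar, e, hqy]
    simp only [mul_smul_comm]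
    module
  · have e : mcZbar (fun t => 𝔽 (π (ψ.symm t))) y = star q' • mcZbar (𝔽 ∘ φ.symm) (q y) := by
      simp only [mcZbar, Function.comp_apply, hqy, h𝔽]
      rw [hzbar, mul_smul_comm]
    rw [hzbar, hΦ.eq_zbar φ hφ _ htar, e, hqy]
    simp only [mul_smul_comm]
    module

end Surfaces

/-! ### Extended frames and extended solutions -/

noncomputable section Frames

variable {n : ℕ} {G : Subgroup (GL (Fin n) ℂ)} {h : G} {w : ℤ → ℝ}

/-- `σ² = id` says that `h²` is central. -/
lemma mul_self_eq_one_of_sigma (hcenter : Subgroup.center G = ⊥)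
    (hinvol : ∀ g : G, sigma h (sigma h g) = g) : h * h = 1 := by
  have hmem : h * h ∈ Subgroup.center G := Subgroup.mem_center_iff.2 fun g => by
    have h1 : h * (h * g * h⁻¹) * h⁻¹ = g := hinvol g
    calc g * (h * h) = (h * (h * g * h⁻¹) * h⁻¹) * (h * h) := by rw [h1]
      _ = h * h * g := by group
  rwa [hcenter, Subgroup.mem_bot] at hmem

lemma mcForm_congr {ε x : ℂ} {u v : ℂ → G} (huv : u =ᶠ[𝓝 x] v) : mcForm ε u x = mcForm ε v x := by
  rw [mcForm, mcForm, huv.eq_of_nhds, wirtinger_congr (huv.mono fun y hy => congrArg mat hy)]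

lemma mcForm_neg_I (u : ℂ → G) (x : ℂ) : mcForm (-Complex.I) u x = mcZ u x := by
  rw [mcForm, wirtinger_neg_I, mcZ]

lemma mcForm_I (u : ℂ → G) (x : ℂ) : mcForm Complex.I u x = mcZbar u x := rfl

section

variable {M : Type*} {N : Type*} [TopologicalSpace N] [ChartedSpace ℂ N]
variable {π : N → M} {𝓕 : M → G ⧸ fixK h} {z₀ : N} {S : Set N} {F : N → Circle → G}

lemma IsExtendedFrame.finite (hF : IsExtendedFrame w h π 𝓕 z₀ S F) : S.Finite :=
  Set.finite_of_encard_le_coe (k := 2) hF.sing_card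

lemma IsExtendedFrame.cartan_eq (hF : IsExtendedFrame w h π 𝓕 z₀ S F) {z : N} (hz : z ∉ S) :
    cartan h (𝓕 (π z)) = F z 1 * h * (F z 1)⁻¹ := by
  rw [← hF.lift z hz]
  rfl

lemma IsExtendedFrame.apply_neg (hF : IsExtendedFrame w h π 𝓕 z₀ S F) {z : N} (hz : z ∉ S)
    (l : Circle) : F z (-l) = h⁻¹ * F z l * h := by
  have h1 : h * F z (-l) * h⁻¹ = F z l := (hF.twisted z hz).2 l
  rw [← h1]
  group

variable [TopologicalSpace M] [ChartedSpace ℂ M] [IsManifold 𝓘(ℂ) ω M]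
variable {Φ : M → Circle → G}

/-- Multiplication by a loop that is `e` at `-1` preserves extended solutions. -/
lemma IsExtendedSolution.const_mul {𝔽 : M → G} (hΦ : IsExtendedSolution w 𝔽 Φ) {B : Circle → G}
    (hB : ∀ p, B * Φ p ∈ basedLoops G w) (hB1 : B (-1) = 1) :
    IsExtendedSolution w 𝔽 fun p => B * Φ p where
  smooth l i j := by
    have : (fun p => mat ((B * Φ p) l) i j) =
        fun p => ∑ k, mat (B l) i k * mat (Φ p l) k j := by
      ext p
      rw [Pi.mul_apply, mat_mul, Matrix.mul_apply]
    rw [this]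
    exact contMDiffOn_finsetSum fun k _ =>
      ((contDiff_const (c := mat (B l) i k)).mul contDiff_id).contMDiff.comp_contMDiffOn
        (hΦ.smooth l k j)
  based := hB
  eval_neg_one p := by rw [Pi.mul_apply, hB1, one_mul, hΦ.eval_neg_one]
  eq_z φ hφ x hx l := by
    have hd := (hΦ.smooth l).entryDiff isOpen_univ hφ hx trivial
    simp only [Pi.mul_apply, mat_mul]
    rw [← wirtinger_neg_I, wirtinger_mul (entryDiff_const _) hd, wirtinger_const, zero_mul,
      zero_add, wirtinger_neg_I, hΦ.eq_z φ hφ x hx l]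
    simp only [mul_smul_comm, mul_assoc]
  eq_zbar φ hφ x hx l := by
    have hd := (hΦ.smooth l).entryDiff isOpen_univ hφ hx trivial
    simp only [Pi.mul_apply, mat_mul]
    rw [← wirtinger_I, wirtinger_mul (entryDiff_const _) hd, wirtinger_const, zero_mul,
      zero_add, wirtinger_I, hΦ.eq_zbar φ hφ x hx l]
    simp only [mul_smul_comm, mul_assoc]

variable [T2Space N] [IsManifold 𝓘(ℂ) ω N]

/-- Both `Φ ∘ π` and `F_λ F₁⁻¹` solve the linear equation determined by `𝔽 ∘ π = F₁ h F₁⁻¹`, so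
their quotient is locally constant. -/
lemma IsExtendedFrame.eventually_quotient_eq (hG : IsCompact (G : Set (GL (Fin n) ℂ)))
    (hh : h * h = 1) (hπ : MDifferentiable 𝓘(ℂ) 𝓘(ℂ) π) (hF : IsExtendedFrame w h π 𝓕 z₀ S F)
    (hΦ : IsExtendedSolution w (cartan h ∘ 𝓕) Φ) (l : Circle) {z : N} (hz : z ∉ S) :
    ∀ᶠ y in 𝓝 z, Φ (π y) l * F y 1 * (F y l)⁻¹ = Φ (π z) l * F z 1 * (F z l)⁻¹ := by
  have hSo : IsOpen Sᶜ := hF.finite.isClosed.isOpen_compl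
  set ψ := chartAt ℂ z
  have hψ : ψ ∈ atlas ℂ N := chart_mem_atlas ℂ z
  have hzs : z ∈ ψ.source := mem_chart_source ℂ z
  have hψz : ψ.symm (ψ z) = z := ψ.left_inv hzs
  have hev : ∀ᶠ t in 𝓝 (ψ z), t ∈ ψ.target ∧ ψ.symm t ∈ Sᶜ :=
    (ψ.open_target.eventually_mem (ψ.map_source hzs)).and
      ((ψ.continuousAt_symm (ψ.map_source hzs)).preimage_mem_nhds
        (hSo.mem_nhds (by rwa [hψz])))
  have hFdiff : ∀ t ∈ ψ.target, ψ.symm t ∈ Sᶜ → ∀ l, EntryDiff (fun t => mat (F (ψ.symm t) l)) t :=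
    fun t ht htS l => (hF.smooth l).entryDiff hSo hψ ht htS
  have hcartan : ∀ t ∈ ψ.target, ψ.symm t ∈ Sᶜ →
      (fun t => (cartan h ∘ 𝓕) (π (ψ.symm t))) =ᶠ[𝓝 t]
        fun t => F (ψ.symm t) 1 * h * (F (ψ.symm t) 1)⁻¹ := fun t ht htS => by
    filter_upwards [(ψ.continuousAt_symm ht).preimage_mem_nhds (hSo.mem_nhds htS)] with s hs
    exact hF.cartan_eq hs
  have key : ∀ᶠ t in 𝓝 (ψ z), mat (Φ (π (ψ.symm t)) l * F (ψ.symm t) 1 * (F (ψ.symm t) l)⁻¹) =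
      mat (Φ (π (ψ.symm (ψ z))) l * F (ψ.symm (ψ z)) 1 * (F (ψ.symm (ψ z)) l)⁻¹) := by
    refine eventually_eq_of_wirtinger_eq_zero (hev.mono ?_) (hev.mono ?_) (hev.mono ?_)
    · rintro t ⟨ht, htS⟩
      exact ((hΦ.pullback hπ hψ ht l).1.mul (hFdiff t ht htS 1)).mul
        ((hFdiff t ht htS l).mat_inv hG)
    · rintro t ⟨ht, htS⟩
      obtain ⟨h1, h2, -⟩ := hΦ.pullback hπ hψ ht l
      rw [← wirtinger_neg_I]
      refine wirtinger_quotient_eq_zero hG hh (c := (l : ℂ)⁻¹) (hFdiff t ht htS 1)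
        (hFdiff t ht htS l) h1 ?_ ?_
      · simp only [mcForm_neg_I]
        exact hF.mc_z ψ hψ t ht htS l
      · rw [wirtinger_neg_I, h2, ← mcForm_neg_I, mcForm_congr (hcartan t ht htS)]
    · rintro t ⟨ht, htS⟩
      obtain ⟨h1, -, h2⟩ := hΦ.pullback hπ hψ ht l
      rw [← wirtinger_I]
      refine wirtinger_quotient_eq_zero hG hh (c := (l : ℂ)) (hFdiff t ht htS 1)
        (hFdiff t ht htS l) h1 ?_ ?_
      · simp only [mcForm_I]
        rw [add_comm]
        exact hF.mc_zbar ψ hψ t ht htS l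
      · rw [wirtinger_I, h2, ← mcForm_I, mcForm_congr (hcartan t ht htS)]
  filter_upwards [(ψ.continuousAt hzs).eventually key, ψ.open_source.mem_nhds hzs] with y hy hys
  have := mat_injective hy
  rwa [ψ.left_inv hys, hψz] at this

/-- The formula expressing an extended solution through an extended frame, obtained by evaluating the
constant quotient at the base point `z₀`, where `F` is `e`. -/
lemma IsExtendedFrame.extendedSolution_eq [PreconnectedSpace N]
    (hG : IsCompact (G : Set (GL (Fin n) ℂ)))
    (hh : h * h = 1) (hπ : MDifferentiable 𝓘(ℂ) 𝓘(ℂ) π) (hF : IsExtendedFrame w h π 𝓕 z₀ S F)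
    (hΦ : IsExtendedSolution w (cartan h ∘ 𝓕) Φ) (l : Circle) {z : N} (hz : z ∉ S) :
    Φ (π z) l = Φ (π z₀) l * F z l * (F z 1)⁻¹ := by
  have h1 := eq_of_locally_constant_compl_finite hF.finite
    (fun z hz => hF.eventually_quotient_eq hG hh hπ hΦ l hz) hF.base_notMem hz
  rw [hF.base, hF.base, mul_one, inv_one, mul_one] at h1
  rw [← h1]
  group

/-- A loop homomorphism `γ` with `γ(-1) = h` normalizes `Φ` to the fixed points of `𝕋`: off the
singular set this is the twistedness of `F`, and the singular set is nowhere dense. -/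
lemma IsExtendedFrame.invT_eq [PreconnectedSpace N]
    (hG : IsCompact (G : Set (GL (Fin n) ℂ)))
    (hh : h * h = 1) (hπ : MDifferentiable 𝓘(ℂ) 𝓘(ℂ) π) (hsurj : Function.Surjective π)
    (hF : IsExtendedFrame w h π 𝓕 z₀ S F)
    (hΦ : IsExtendedSolution w (cartan h ∘ 𝓕) Φ) {γ : Circle → G}
    (hγ : ∀ a b, γ (a * b) = γ a * γ b) (hγh : γ (-1) = h) (p : M) :
    invT (γ * (Φ (π z₀))⁻¹ * Φ p) = γ * (Φ (π z₀))⁻¹ * Φ p := by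
  have hγ1 : γ 1 = 1 := by
    have := hγ 1 1
    rwa [one_mul, left_eq_mul] at this
  have hγneg : ∀ l, γ (-l) = γ l * h := fun l => by rw [← hγh, ← hγ, mul_neg_one]
  set B : Circle → G := γ * (Φ (π z₀))⁻¹
  have hformula : ∀ z ∉ S, ∀ l, (B * Φ (π z)) l = γ l * F z l * (F z 1)⁻¹ := fun z hz l => by
    rw [Pi.mul_apply, hF.extendedSolution_eq hG hh hπ hΦ l hz]
    simp only [B, Pi.mul_apply, Pi.inv_apply]
    group
  suffices hall : ∀ z l, (B * Φ (π z)) (-l) = (B * Φ (π z)) l * (B * Φ (π z)) (-1) by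
    obtain ⟨z, rfl⟩ := hsurj p
    ext1 l
    rw [invT, hall z l, mul_inv_cancel_right]
  intro z l
  have hcont : ∀ l, Continuous fun z => mat (Φ (π z) l) := fun l =>
    (hΦ.smooth l).continuous_mat.comp hπ.continuous
  refine mat_injective (congrFun (Continuous.ext_on (dense_compl_finite_of_chartedSpace hF.finite)
    (f := fun z => mat ((B * Φ (π z)) (-l)))
    (g := fun z => mat ((B * Φ (π z)) l * (B * Φ (π z)) (-1))) ?_ ?_ fun z hz => ?_) z)
  · simp only [Pi.mul_apply, mat_mul]
    exact continuous_const.matrix_mul (hcont _)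
  · simp only [Pi.mul_apply, mat_mul]
    exact (continuous_const.matrix_mul (hcont _)).matrix_mul
      (continuous_const.matrix_mul (hcont _))
  · simp only [hformula z hz]
    congr 1
    rw [hF.apply_neg hz l, hF.apply_neg hz 1, hγneg, hγh]
    group

end

/-! ### The normalizing loop -/

/-- Every element of a torus is `exp (π ξ)` for some `ξ` in the Lie algebra of the torus. -/
lemma exists_exp_pi_smul_eq {T : Subgroup G} (hT : IsTorus T) (hhT : h ∈ T) :
    ∃ ξ ∈ lieAlg T, exp (Real.pi • ξ) = mat h := by
  obtain ⟨X, hX, hXh⟩ := exists_mem_lieAlg_exp_eq hT.compact hT.connected.isPreconnected hhT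
  refine ⟨Real.pi⁻¹ • X, fun t => ?_, ?_⟩
  · obtain ⟨g, hg, hgX⟩ := hX (t * Real.pi⁻¹)
    exact ⟨g, hg, by rw [hgX, mul_smul]⟩
  · rw [smul_smul, mul_inv_cancel₀ Real.pi_ne_zero, one_smul, hXh]

/-- If `h² = e` and `exp (π ξ) = h`, then `exp (t ξ)` defines a loop `γ` with values in `G`, and
`γ(-1) = h`. -/
lemma exists_loop_of_exp_pi_smul_eq (hh : h * h = 1) {H : Subgroup G}
    {ξ : Matrix (Fin n) (Fin n) ℂ} (hξ : ξ ∈ lieAlg H) (hξh : exp (Real.pi • ξ) = mat h) :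
    ∃ γ : Circle → G, (∀ t : ℝ, mat (γ (Circle.exp t)) = exp (t • ξ)) ∧
      (∀ a b, γ (a * b) = γ a * γ b) ∧ HasEntriesIn trigAlgebra γ ∧ γ (-1) = h := by
  obtain ⟨γ, hγ, hmul, htrig⟩ := exists_loop_of_periodic hξ (by
    rw [two_mul, matrix_exp_add_smul, hξh, ← mat_mul, hh, mat_one])
  refine ⟨γ, hγ, hmul, htrig, mat_injective ?_⟩
  have h1 : Circle.exp Real.pi = -1 := by
    ext
    simp [Circle.coe_exp, Complex.exp_pi_mul_I]
  rw [← h1, hγ, hξh]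

end Frames

end UnitonLoops

theorem mainTheorem4 {n : ℕ} (G : Subgroup (GL (Fin n) ℂ))
    (hG_compact : IsCompact (G : Set (GL (Fin n) ℂ)))
    (hG_connected : IsConnected (G : Set (GL (Fin n) ℂ)))
    (hG_center : Subgroup.center G = ⊥)
    (h : G) (h_invol : ∀ g : G, UnitonLoops.sigma h (UnitonLoops.sigma h g) = g)
    (w : ℤ → ℝ) (hw : UnitonLoops.IsLoopWeight w)
    {M : Type*} [TopologicalSpace M] [T2Space M] [ConnectedSpace M] [ChartedSpace ℂ M]
    [IsManifold 𝓘(ℂ) ω M]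
    {N : Type*} [TopologicalSpace N] [T2Space N] [ChartedSpace ℂ N] [IsManifold 𝓘(ℂ) ω N]
    (π : N → M) (hπ : UnitonLoops.IsUniversalCovering π)
    (𝓕 : M → G ⧸ UnitonLoops.fixK h) (h𝓕 : UnitonLoops.IsHarmonic h 𝓕)
    (h𝓕_uniton : UnitonLoops.HasFiniteUnitonNumber w (UnitonLoops.cartan h ∘ 𝓕))
    (z₀ : N) (S : Set N) (F : N → Circle → G)
    (hF : UnitonLoops.IsExtendedFrame w h π 𝓕 z₀ S F)
    (Φ : M → Circle → G)
    (hΦ : UnitonLoops.IsExtendedSolution w (UnitonLoops.cartan h ∘ 𝓕) Φ)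
    (A : Circle → G) (hA : ∀ l : Circle, A l = (Φ (π z₀) l)⁻¹) :
    (∀ z, z ∉ S → ∀ l : Circle, Φ (π z) l = (A l)⁻¹ * F z l * (F z 1)⁻¹) ∧
    (∃ T : Subgroup G, UnitonLoops.IsMaximalTorus T ∧ h ∈ T) ∧
    ∀ T : Subgroup G, UnitonLoops.IsMaximalTorus T → h ∈ T →
      (∃ ξ ∈ UnitonLoops.lieAlg T, NormedSpace.exp (Real.pi • ξ) = UnitonLoops.mat h) ∧
      ∀ ξ ∈ UnitonLoops.lieAlg T, NormedSpace.exp (Real.pi • ξ) = UnitonLoops.mat h →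
        ∃ γξ : Circle → G,
          (∀ t : ℝ, UnitonLoops.mat (γξ (Circle.exp t)) = NormedSpace.exp (t • ξ)) ∧
          γξ * A ∈ UnitonLoops.basedLoops G w ∧
          (γξ * A) (-1) = 1 ∧
          (∀ p : M, γξ * A * Φ p ∈ UnitonLoops.basedLoops G w ∧
            UnitonLoops.invT (γξ * A * Φ p) = γξ * A * Φ p) ∧
          UnitonLoops.IsExtendedSolution w (UnitonLoops.cartan h ∘ 𝓕)
            (fun p => γξ * A * Φ p) ∧
          ((∀ p : M, Φ p ∈ UnitonLoops.algLoops G) →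
            γξ * A ∈ UnitonLoops.algLoops G ∧
            ∀ p : M, γξ * A * Φ p ∈ UnitonLoops.algLoopsT G) := by

  have hh := UnitonLoops.mul_self_eq_one_of_sigma hG_center h_invol
  have := hπ.simplyConnected
  have hformula := fun z hz l => hF.extendedSolution_eq hG_compact hh hπ.holomorphic hΦ l (z := z) hz
  obtain rfl : A = (Φ (π z₀))⁻¹ := funext hA
  have hA1 : (Φ (π z₀))⁻¹ 1 = 1 := by rw [Pi.inv_apply, (hΦ.based _).2, inv_one]
  -- `F` is `e` at `z₀`, so `𝔽 (π z₀) = h`.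
  have hAneg : (Φ (π z₀))⁻¹ (-1) = h⁻¹ := by
    rw [Pi.inv_apply, hΦ.eval_neg_one, Function.comp_apply, hF.cartan_eq hF.base_notMem, hF.base,
      one_mul, inv_one, mul_one]
  refine ⟨fun z hz l => ?_, UnitonLoops.exists_isMaximalTorus_mem hG_compact hG_connected h,
    fun T hT hhT => ⟨UnitonLoops.exists_exp_pi_smul_eq hT.prop hhT, fun ξ hξ hξh => ?_⟩⟩
  · rw [Pi.inv_apply, inv_inv]
    exact hformula z hz l
  obtain ⟨γ, hγ, hmul, htrig, hγh⟩ := UnitonLoops.exists_loop_of_exp_pi_smul_eq hh hξ hξh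
  have hγ1 : γ 1 = 1 := by
    have := hmul 1 1
    rwa [one_mul, left_eq_mul] at this
  have hB1 : (γ * (Φ (π z₀))⁻¹) 1 = 1 := by rw [Pi.mul_apply, hγ1, hA1, one_mul]
  have hBneg : (γ * (Φ (π z₀))⁻¹) (-1) = 1 := by
    rw [Pi.mul_apply, hγh, hAneg, mul_inv_cancel]
  have hΦ𝒲 : ∀ p, UnitonLoops.HasEntriesIn (UnitonLoops.wienerAlgebra hw) (Φ p) := fun p =>
    (UnitonLoops.mem_loopGroup_iff hw).1 (hΦ.based p).1
  have hB𝒲 : UnitonLoops.HasEntriesIn (UnitonLoops.wienerAlgebra hw) (γ * (Φ (π z₀))⁻¹) :=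
    UnitonLoops.HasEntriesIn.mul
      (fun i j => UnitonLoops.trigAlgebra_le_wienerAlgebra hw (htrig i j))
      ((hΦ𝒲 _).inv hG_compact fun f => UnitonLoops.star_mem_wienerAlgebra hw)
  have hprod1 : ∀ p, (γ * (Φ (π z₀))⁻¹ * Φ p) 1 = 1 := fun p => by
    rw [Pi.mul_apply, hB1, (hΦ.based p).2, one_mul]
  have hprod : ∀ p, γ * (Φ (π z₀))⁻¹ * Φ p ∈ UnitonLoops.basedLoops G w := fun p =>
    ⟨(UnitonLoops.mem_loopGroup_iff hw).2 (hB𝒲.mul (hΦ𝒲 p)), hprod1 p⟩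
  have hinvT := fun p =>
    hF.invT_eq hG_compact hh hπ.holomorphic hπ.surjective hΦ hmul hγh p
  refine ⟨γ, hγ, ⟨(UnitonLoops.mem_loopGroup_iff hw).2 hB𝒲, hB1⟩, hBneg,
    fun p => ⟨hprod p, hinvT p⟩, hΦ.const_mul hprod hBneg, fun halg => ?_⟩
  have hΦtrig : ∀ p, UnitonLoops.HasEntriesIn UnitonLoops.trigAlgebra (Φ p) := fun p =>
    (UnitonLoops.mem_algLoops_iff.1 (halg p)).2
  have hBtrig : UnitonLoops.HasEntriesIn UnitonLoops.trigAlgebra (γ * (Φ (π z₀))⁻¹) :=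
    htrig.mul ((hΦtrig _).inv hG_compact fun f => UnitonLoops.star_mem_trigAlgebra)
  exact ⟨UnitonLoops.mem_algLoops_iff.2 ⟨hB1, hBtrig⟩, fun p =>
    ⟨UnitonLoops.mem_algLoops_iff.2 ⟨hprod1 p, hBtrig.mul (hΦtrig p)⟩, hinvT p⟩⟩
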